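/- Let \(\mathcal H_A,\mathcal H_B\) be separable (possibly infinite-dimensional) complex Hilbert spaces and let \(\rho\) be a quantum state on \(\mathcal H_A\otimes\mathcal H_B\) (a positive semi-definite trace class operator with unit trace). All logarithms are to base two, with \(\log 0=-\infty\); exponents take values in \([-\infty,+\infty]\). For Hilbert spaces \(X,Y\), let \(\mathcal S_{X:Y}\) be the set of separable states on \(X\otimes Y\), i.e. the trace-norm closure of the convex hull of the pure product states \(|\psi\rangle\langle\psi|\otimes|\varphi\rangle\langle\varphi|\) with unit vectors \(\psi\in X\), \(\varphi\in Y\). Write \(A_n:=\mathcal H_A^{\otimes n}\), \(B_n:=\mathcal H_B^{\otimes n}\), and regard \(\rho^{\otimes n}\) as a state on \(A_n\otimes B_n\). Let \(A_0=B_0=\mathbb C^2\) and let \(\Phi=|\Phi\rangle\langle\Phi|\), \(|\Phi\rangle=\frac1{\sqrt2}(|00\rangle+|11\rangle)\), be the maximally entangled state on \(A_0\otimes B_0\). Let \(\mathsf{NE}_{n\to m}\) be the set of completely positive, trace preserving bounded linear maps \(\Lambda:\mathcal T(A_n\otimes B_n)\to\mathcal T(A_0^{\otimes m}\otimes B_0^{\otimes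 m})\) between the spaces of trace class operators such that \(\Lambda(\sigma)\) is separable across \(A_0^{\otimes m}:B_0^{\otimes m}\) for all \(\sigma\in\mathcal S_{A_n:B_n}\). With the fidelity \(F(\omega,\tau)=\|\sqrt\omega\sqrt\tau\|_1^2\), define \[ E^{(m)}_{d,\mathrm{err}}(\rho):=\sup\Big\{\liminf_{n\to\infty}-\tfrac1n\log\varepsilon_n \;:\; F\big(\Lambda_n(\rho^{\otimes n}),\Phi^{\otimes m}\big)\ge 1-\varepsilon_n,\ \Lambda_n\in\mathsf{NE}_{n\to m}\ \text{for all } n\Big\}, \] the supremum being over sequences \((\varepsilon_n)_n\) in \([0,\infty)\) and \((\Lambda_n)_n\), and the error exponent of entanglement distillation under non-entangling operations \[ E_{d,\mathrm{err}}(\rho):=\lim_{m\to\infty}E^{(m)}_{d,\mathrm{err}}(\rho). \] Define further \[ D_H^\varepsilon(\sigma\|\omega):=-\log\inf\{\operatorname{tr}(M\omega): 0\le M\le 1,\ \operatorname{tr}((1-M)\sigma)\le\varepsilon\}, \qquad D_H^\varepsilon(\mathcal S_{X:Y}\|\omega):=\inf_{\sigma\in\mathcal S_{X:Y}}D_H^\varepsilon(\sigma\|\omega),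 \] where \(M\) ranges over bounded operators, and the Sanov exponent of entanglement testing \[ \mathrm{Sanov}(\rho\|\mathcal S_{A:B}):=\lim_{\varepsilon\to0^+}\liminf_{n\to\infty}\tfrac1n D_H^\varepsilon\big(\mathcal S_{A_n:B_n}\big\|\rho^{\otimes n}\big). \] Then both limits, \(m\to\infty\) and \(\varepsilon\to0^+\), exist, and \[ E_{d,\mathrm{err}}(\rho)=\mathrm{Sanov}(\rho\|\mathcal S_{A:B}). \] -/

import Mathlib

open Filter Topology
open scoped TensorProduct ENNReal NNReal InnerProductSpace ComplexOrder

noncomputable section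

namespace EntTest

universe u v

/-! ### Trace class operators and states on a Hilbert space -/

section Trace

variable {H : Type*} [NormedAddCommGroup H] [InnerProductSpace ℂ H] [CompleteSpace H]
variable {K : Type*} [NormedAddCommGroup K] [InnerProductSpace ℂ K] [CompleteSpace K]

variable (H) in
/-- Index set of a fixed orthonormal basis of `H`. -/
def BasisIndex : Set H := (exists_hilbertBasis ℂ H).choose

variable (H) in
/-- A fixed orthonormal basis of `H`. The traces below do not depend on this choice. -/
def onb : HilbertBasis (BasisIndex H) ℂ H := (exists_hilbertBasis ℂ H).choose_spec.choose

/-- The trace `∑ i, ⟨e i, P e i⟩ ∈ [0, ∞]` of a positive semi-definite bounded operator. -/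
def posTrace (P : H →L[ℂ] H) : ℝ≥0∞ :=
  ∑' i, ENNReal.ofReal (⟪onb H i, P (onb H i)⟫_ℂ).re

/-- The trace norm `tr √(X X†)`. -/
def traceNorm (X : H →L[ℂ] H) : ℝ≥0∞ :=
  posTrace (CFC.sqrt (X * star X))

/-- Membership in the trace class `𝒯(H)`. -/
def IsTraceClass (X : H →L[ℂ] H) : Prop := traceNorm X < ⊤

/-- The trace `∑ i, ⟨e i, X e i⟩` (an absolutely convergent sum if `X` is trace class). -/
def trace (X : H →L[ℂ] H) : ℂ := ∑' i, ⟪onb H i, X (onb H i)⟫_ℂ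

/-- Density operators: positive semi-definite trace class operators with unit trace. -/
def IsState (ρ : H →L[ℂ] H) : Prop := 0 ≤ ρ ∧ IsTraceClass ρ ∧ trace ρ = 1

/-- The projector `|ψ⟩⟨ψ|` onto (the line of) a unit vector. -/
def ketbra (ψ : H) : H →L[ℂ] H := InnerProductSpace.rankOne ℂ ψ ψ

/-- The Uhlmann fidelity `‖√ρ √σ‖₁ ^ 2`. -/
def fidelity (ρ σ : H →L[ℂ] H) : ℝ := (traceNorm (CFC.sqrt ρ * CFC.sqrt σ)).toReal ^ 2

/-- Positive semi-definiteness of the operator `∑ i j, X i j ⊗ |i⟩⟨j|` on `H ⊗ ℂᵏ = Hᵏ`. -/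
def BlockPos {k : ℕ} (X : Fin k → Fin k → (H →L[ℂ] H)) : Prop :=
  ∀ v : Fin k → H, 0 ≤ ∑ i, ∑ j, ⟪v i, X i j (v j)⟫_ℂ

/-- Quantum channels, i.e. completely positive, trace preserving bounded linear maps
`𝒯(H) → 𝒯(K)`. Only the values of `Λ` on trace class operators are constrained (and only these
are ever used). Complete positivity: `Λ ⊗ id` is positive on `𝒯(H ⊗ ℂᵏ)` for every `k`. -/
structure IsChannel (Λ : (H →L[ℂ] H) → (K →L[ℂ] K)) : Prop where
  traceClass : ∀ X, IsTraceClass X → IsTraceClass (Λ X)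
  map_add : ∀ X Y, IsTraceClass X → IsTraceClass Y → Λ (X + Y) = Λ X + Λ Y
  map_smul : ∀ (c : ℂ) (X), IsTraceClass X → Λ (c • X) = c • Λ X
  bounded : ∃ C : ℝ≥0, ∀ X, IsTraceClass X → traceNorm (Λ X) ≤ C * traceNorm X
  completely_pos : ∀ (k : ℕ) (X : Fin k → Fin k → (H →L[ℂ] H)),
    (∀ i j, IsTraceClass (X i j)) → BlockPos X → BlockPos (fun i j => Λ (X i j))
  trace_preserving : ∀ X, IsTraceClass X → trace (Λ X) = trace X

end Trace

/-! ### Hilbert space tensor products -/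

section Tensor

variable (E F G H : Type*)
  [NormedAddCommGroup E] [InnerProductSpace ℂ E] [NormedAddCommGroup F] [InnerProductSpace ℂ F]
  [NormedAddCommGroup G] [InnerProductSpace ℂ G] [NormedAddCommGroup H] [InnerProductSpace ℂ H]

/-- The Hilbert space tensor product: the completion of the algebraic tensor product. -/
abbrev HTensor : Type _ := UniformSpace.Completion (E ⊗[ℂ] F)

variable {E F}

/-- The product vector `x ⊗ y`. -/
def tmul (x : E) (y : F) : HTensor E F := ((x ⊗ₜ[ℂ] y : E ⊗[ℂ] F) : UniformSpace.Completion (E ⊗[ℂ] F))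

/-- The tensor product `S ⊗ T` of bounded operators. -/
def opTensor (S : E →L[ℂ] E) (T : F →L[ℂ] F) : HTensor E F →L[ℂ] HTensor E F :=
  (TensorProduct.mapL S T).completion

theorem opTensor_tmul (S : E →L[ℂ] E) (T : F →L[ℂ] F) (x : E) (y : F) :
    opTensor S T (tmul x y) = tmul (S x) (T y) := by
  unfold opTensor tmul
  rw [ContinuousLinearMap.completion_apply_coe]
  rfl

variable (E F)

/-- The isometric embedding of `(E ⊗ F) ⊗ (G ⊗ H)`, with all tensor products algebraic, into the
iterated Hilbert space tensor product. -/
def algEmb : (E ⊗[ℂ] F) ⊗[ℂ] (G ⊗[ℂ] H) →ₗᵢ[ℂ] HTensor (HTensor E F) (HTensor G H) :=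
  UniformSpace.Completion.toComplₗᵢ.comp
    (TensorProduct.mapIsometry UniformSpace.Completion.toComplₗᵢ UniformSpace.Completion.toComplₗᵢ)

theorem algEmb_tmul (x : E ⊗[ℂ] F) (y : G ⊗[ℂ] H) :
    algEmb E F G H (x ⊗ₜ y) = tmul (x : HTensor E F) (y : HTensor G H) := rfl

theorem denseRange_algEmb : DenseRange (algEmb E F G H) := by
  have key : ∀ t : HTensor E F ⊗[ℂ] HTensor G H, t ∈ closure (Set.range
      (TensorProduct.mapIsometry (UniformSpace.Completion.toComplₗᵢ (𝕜 := ℂ) (E := E ⊗[ℂ] F))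
        (UniformSpace.Completion.toComplₗᵢ (𝕜 := ℂ) (E := G ⊗[ℂ] H)))) := by
    intro t
    have hcl : closure (Set.range
        (TensorProduct.mapIsometry (UniformSpace.Completion.toComplₗᵢ (𝕜 := ℂ) (E := E ⊗[ℂ] F))
        (UniformSpace.Completion.toComplₗᵢ (𝕜 := ℂ) (E := G ⊗[ℂ] H)))) =
        ((LinearMap.range (TensorProduct.mapIsometry
          (UniformSpace.Completion.toComplₗᵢ (𝕜 := ℂ) (E := E ⊗[ℂ] F))
          (UniformSpace.Completion.toComplₗᵢ (𝕜 := ℂ) (E := G ⊗[ℂ] H))).toLinearMap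
            ).topologicalClosure : Set (HTensor E F ⊗[ℂ] HTensor G H)) := rfl
    rw [hcl]
    induction t using TensorProduct.induction_on with
    | zero => exact Submodule.zero_mem _
    | add x y hx hy => exact Submodule.add_mem _ hx hy
    | tmul x y =>
      have hx : DenseRange (Prod.map ((↑) : E ⊗[ℂ] F → HTensor E F)
          ((↑) : G ⊗[ℂ] H → HTensor G H)) :=
        UniformSpace.Completion.denseRange_coe.prodMap UniformSpace.Completion.denseRange_coe
      have := map_mem_closure (f := fun p : HTensor E F × HTensor G H => p.1 ⊗ₜ[ℂ] p.2)
        (TensorProduct.continuous_tmul) (hx (x, y)) (t := Set.range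
        (TensorProduct.mapIsometry (UniformSpace.Completion.toComplₗᵢ (𝕜 := ℂ) (E := E ⊗[ℂ] F))
        (UniformSpace.Completion.toComplₗᵢ (𝕜 := ℂ) (E := G ⊗[ℂ] H)))) (by
          rintro _ ⟨⟨a, b⟩, rfl⟩
          exact ⟨a ⊗ₜ b, rfl⟩)
      rwa [hcl] at this
  have h1 : DenseRange (TensorProduct.mapIsometry
      (UniformSpace.Completion.toComplₗᵢ (𝕜 := ℂ) (E := E ⊗[ℂ] F))
      (UniformSpace.Completion.toComplₗᵢ (𝕜 := ℂ) (E := G ⊗[ℂ] H))) := key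
  exact UniformSpace.Completion.denseRange_coe.comp h1
    (UniformSpace.Completion.continuous_coe _)

theorem norm_tensorTensorTensorComm (x : (E ⊗[ℂ] F) ⊗[ℂ] (G ⊗[ℂ] H)) :
    ‖TensorProduct.tensorTensorTensorComm ℂ E F G H x‖ = ‖x‖ := by
  let e := (TensorProduct.assocIsometry ℂ E F (G ⊗[ℂ] H)).trans
    ((TensorProduct.congrIsometry (LinearIsometryEquiv.refl ℂ E)
      ((TensorProduct.assocIsometry ℂ F G H).symm.trans
        ((TensorProduct.congrIsometry (TensorProduct.commIsometry ℂ F G)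
          (LinearIsometryEquiv.refl ℂ H)).trans (TensorProduct.assocIsometry ℂ G F H)))).trans
      (TensorProduct.assocIsometry ℂ E G (F ⊗[ℂ] H)).symm)
  have h : (TensorProduct.tensorTensorTensorComm ℂ E F G H).toLinearMap =
      e.toLinearEquiv.toLinearMap := by
    apply TensorProduct.ext_fourfold'
    intro x y z w
    rfl
  have := e.norm_map x
  rw [← this]
  exact congrArg norm (LinearMap.congr_fun h x)

/-- The unitary `(E ⊗ F) ⊗ (G ⊗ H) → (E ⊗ G) ⊗ (F ⊗ H)` exchanging the two middle factors. -/
def interchange :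
    HTensor (HTensor E F) (HTensor G H) ≃ₗᵢ[ℂ] HTensor (HTensor E G) (HTensor F H) :=
  (TensorProduct.tensorTensorTensorComm ℂ E F G H).extendOfIsometry
    (algEmb E F G H).toLinearMap (algEmb E G F H).toLinearMap
    (denseRange_algEmb E F G H) (denseRange_algEmb E G F H)
    (fun x => by
      simp only [LinearIsometry.coe_toLinearMap, LinearIsometry.norm_map,
        norm_tensorTensorTensorComm])

variable {E F G H}

theorem interchange_tmul (x : E) (y : F) (z : G) (w : H) :
    interchange E F G H (tmul (tmul x y) (tmul z w)) = tmul (tmul x z) (tmul y w) :=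
  LinearEquiv.extendOfIsometry_eq _ _ _ _ _ _ ((x ⊗ₜ y) ⊗ₜ (z ⊗ₜ w))

end Tensor

/-! ### Tensor powers -/

section Power

/-- A bundled complex Hilbert space. -/
structure HilbertSp : Type (u + 1) where
  carrier : Type u
  [normed : NormedAddCommGroup carrier]
  [inner : InnerProductSpace ℂ carrier]
  [complete : CompleteSpace carrier]

attribute [instance] HilbertSp.normed HilbertSp.inner HilbertSp.complete

variable (A : Type u) [NormedAddCommGroup A] [InnerProductSpace ℂ A] [CompleteSpace A]
variable (B : Type v) [NormedAddCommGroup B] [InnerProductSpace ℂ B] [CompleteSpace B]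

/-- `A^{⊗ n}`: the one-dimensional space for `n = 0`, and `A^{⊗ (n + 1)} = A^{⊗ n} ⊗ A`. -/
def powSp : ℕ → HilbertSp.{u}
  | 0 => ⟨EuclideanSpace ℂ PUnit.{u + 1}⟩
  | n + 1 => ⟨HTensor (powSp n).carrier A⟩

/-- The Hilbert space `A^{⊗ n}`. -/
abbrev TPow (n : ℕ) : Type u := (powSp A n).carrier

/-- The bipartite Hilbert space `A^{⊗ n} ⊗ B^{⊗ n}` of `n` copies, with the cut `A^{⊗ n} : B^{⊗ n}`. -/
abbrev Copies (n : ℕ) : Type (max u v) := HTensor (TPow A n) (TPow B n)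

variable {A B}

/-- The unitary `(X ⊗ Y) ⊗ (A ⊗ B) → X' ⊗ Y'` if `X' = X ⊗ A` and `Y' = Y ⊗ B`. -/
def regroupAux (A : Type u) [NormedAddCommGroup A] [InnerProductSpace ℂ A]
    (B : Type v) [NormedAddCommGroup B] [InnerProductSpace ℂ B]
    (X X' : HilbertSp.{u}) (Y Y' : HilbertSp.{v})
    (hX : X' = ⟨HTensor X.carrier A⟩) (hY : Y' = ⟨HTensor Y.carrier B⟩) :
    HTensor (HTensor X.carrier Y.carrier) (HTensor A B) ≃ₗᵢ[ℂ] HTensor X'.carrier Y'.carrier := by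
  subst hX
  subst hY
  exact interchange X.carrier Y.carrier A B

/-- The unitary regrouping `(A^{⊗ n} ⊗ B^{⊗ n}) ⊗ (A ⊗ B) → A^{⊗ (n + 1)} ⊗ B^{⊗ (n + 1)}`. -/
def regroup (A : Type u) [NormedAddCommGroup A] [InnerProductSpace ℂ A] [CompleteSpace A]
    (B : Type v) [NormedAddCommGroup B] [InnerProductSpace ℂ B] [CompleteSpace B] (n : ℕ) :
    HTensor (Copies A B n) (HTensor A B) ≃ₗᵢ[ℂ] Copies A B (n + 1) :=
  regroupAux A B (powSp A n) (powSp A (n + 1)) (powSp B n) (powSp B (n + 1)) rfl rfl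

/-- The product vector `x ⊗ a` in `X' = X ⊗ A`. -/
def snocAux {A : Type u} [NormedAddCommGroup A] [InnerProductSpace ℂ A]
    (X X' : HilbertSp.{u}) (hX : X' = ⟨HTensor X.carrier A⟩) (x : X.carrier) (a : A) :
    X'.carrier := by
  subst hX
  exact tmul x a

/-- The product vector `x ⊗ a` in `A^{⊗ (n + 1)} = A^{⊗ n} ⊗ A`. -/
def snoc {n : ℕ} (x : TPow A n) (a : A) : TPow A (n + 1) :=
  snocAux (powSp A n) (powSp A (n + 1)) rfl x a

theorem regroupAux_tmul {A : Type u} [NormedAddCommGroup A] [InnerProductSpace ℂ A]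
    {B : Type v} [NormedAddCommGroup B] [InnerProductSpace ℂ B]
    (X X' : HilbertSp.{u}) (Y Y' : HilbertSp.{v})
    (hX : X' = ⟨HTensor X.carrier A⟩) (hY : Y' = ⟨HTensor Y.carrier B⟩)
    (x : X.carrier) (y : Y.carrier) (a : A) (b : B) :
    regroupAux A B X X' Y Y' hX hY (tmul (tmul x y) (tmul a b)) =
      tmul (snocAux X X' hX x a) (snocAux Y Y' hY y b) := by
  subst hX
  subst hY
  exact interchange_tmul x y a b

theorem regroup_tmul {n : ℕ} (x : TPow A n) (y : TPow B n) (a : A) (b : B) :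
    regroup A B n (tmul (tmul x y) (tmul a b)) = tmul (snoc x a) (snoc y b) :=
  regroupAux_tmul _ _ _ _ _ _ x y a b

/-- The `n`-fold tensor power `ρ^{⊗ n}` of an operator on `A ⊗ B`, as an operator on
`A^{⊗ n} ⊗ B^{⊗ n}`. -/
def opPow (ρ : HTensor A B →L[ℂ] HTensor A B) : (n : ℕ) → Copies A B n →L[ℂ] Copies A B n
  | 0 => 1
  | n + 1 =>
    (regroup A B n : HTensor (Copies A B n) (HTensor A B) →L[ℂ] Copies A B (n + 1)) ∘L
      opTensor (opPow ρ n) ρ ∘L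
      ((regroup A B n).symm : Copies A B (n + 1) →L[ℂ] HTensor (Copies A B n) (HTensor A B))

end Power

/-! ### Separable states and non-entangling operations -/

section Separable

variable (A : Type u) [NormedAddCommGroup A] [InnerProductSpace ℂ A] [CompleteSpace A]
variable (B : Type v) [NormedAddCommGroup B] [InnerProductSpace ℂ B] [CompleteSpace B]

/-- The pure product states `|ψ⟩⟨ψ| ⊗ |φ⟩⟨φ|` on `A ⊗ B`. -/
def pureProduct : Set (HTensor A B →L[ℂ] HTensor A B) :=
  {X | ∃ (ψ : A) (φ : B), ‖ψ‖ = 1 ∧ ‖φ‖ = 1 ∧ X = opTensor (ketbra ψ) (ketbra φ)}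

/-- The set of separable states on `A ⊗ B`: the trace norm closure of the convex hull of the pure
product states. -/
def separable : Set (HTensor A B →L[ℂ] HTensor A B) :=
  {σ | ∀ δ : ℝ≥0∞, 0 < δ → ∃ τ ∈ convexHull ℝ (pureProduct A B), traceNorm (σ - τ) < δ}

/-- A single qubit. -/
abbrev Qubit : Type := EuclideanSpace ℂ (Fin 2)

/-- The maximally entangled two-qubit vector `(|00⟩ + |11⟩) / √2`. -/
def bellVector : HTensor Qubit Qubit :=
  ((1 / √2 : ℝ) : ℂ) • (tmul (EuclideanSpace.single 0 1) (EuclideanSpace.single 0 1) +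
    tmul (EuclideanSpace.single 1 1) (EuclideanSpace.single 1 1))

/-- The maximally entangled two-qubit state `Φ`. -/
def bell : HTensor Qubit Qubit →L[ℂ] HTensor Qubit Qubit := ketbra bellVector

/-- The non-entangling operations from `n` copies of `A ⊗ B` to `m` copies of two qubits. -/
def NE (n m : ℕ) : Set ((Copies A B n →L[ℂ] Copies A B n) →
    (Copies Qubit Qubit m →L[ℂ] Copies Qubit Qubit m)) :=
  {Λ | IsChannel Λ ∧
    ∀ σ ∈ separable (TPow A n) (TPow B n), Λ σ ∈ separable (TPow Qubit m) (TPow Qubit m)}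

end Separable

/-! ### The two exponents -/

/-- The logarithm to base two on `[0, ∞]`, with `log 0 = -∞`. -/
def log2 (x : ℝ≥0∞) : EReal := ENNReal.log x / (Real.log 2 : EReal)

section Exponents

variable {A : Type u} [NormedAddCommGroup A] [InnerProductSpace ℂ A] [CompleteSpace A]
variable {B : Type v} [NormedAddCommGroup B] [InnerProductSpace ℂ B] [CompleteSpace B]

/-- The distillable entanglement error exponent for `m` copies. -/
def distillExponentCopies (ρ : HTensor A B →L[ℂ] HTensor A B) (m : ℕ) : EReal :=
  sSup {x | ∃ (ε : ℕ → ℝ≥0) (Λ : (n : ℕ) → ((Copies A B n →L[ℂ] Copies A B n) →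
      (Copies Qubit Qubit m →L[ℂ] Copies Qubit Qubit m))),
    (∀ n, Λ n ∈ NE A B n m) ∧
    (∀ n, fidelity (Λ n (opPow ρ n)) (opPow bell m) ≥ 1 - (ε n : ℝ)) ∧
    x = liminf (fun n : ℕ => ((1 / n : ℝ) : EReal) * (-log2 (ε n))) atTop}

/-- The asymptotic error exponent of entanglement distillation, `lim_{m → ∞}`. -/
def distillExponent (ρ : HTensor A B →L[ℂ] HTensor A B) : EReal :=
  limUnder atTop (distillExponentCopies ρ)

/-- The hypothesis testing relative entropy
`-log inf {tr (M ρ) : 0 ≤ M ≤ 1, tr ((1 - M) σ) ≤ ε}`. -/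
def hypoTest {H : Type*} [NormedAddCommGroup H] [InnerProductSpace ℂ H] [CompleteSpace H]
    (ε : ℝ) (σ ρ : H →L[ℂ] H) : EReal :=
  -log2 (sInf {t | ∃ M : H →L[ℂ] H, 0 ≤ M ∧ M ≤ 1 ∧ (trace ((1 - M) * σ)).re ≤ ε ∧
    t = ENNReal.ofReal (trace (M * ρ)).re})

/-- The hypothesis testing relative entropy of entanglement testing,
`inf_σ D_H^ε(σ ‖ ρ)` over the separable states `σ`. -/
def hypoTestSep (ε : ℝ) (ρ : HTensor A B →L[ℂ] HTensor A B) : EReal :=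
  ⨅ σ ∈ separable A B, hypoTest ε σ ρ

/-- The asymptotic exponent `liminf_n (1/n) D_H^ε(S ‖ ρ^{⊗ n})` of the type-1 error at type-2
error threshold `ε`. -/
def sanovExponentAt (ρ : HTensor A B →L[ℂ] HTensor A B) (ε : ℝ) : EReal :=
  liminf (fun n : ℕ => ((1 / n : ℝ) : EReal) * hypoTestSep ε (opPow ρ n)) atTop

/-- The Sanov exponent of entanglement testing, `lim_{ε → 0+}`. -/
def sanovExponent (ρ : HTensor A B →L[ℂ] HTensor A B) : EReal :=
  limUnder (𝓝[>] 0) (sanovExponentAt ρ)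

end Exponents

end EntTest

end

open EntTest

/-!
The two exponents are squeezed between each other. Write `S(ε)` for `sanovExponentAt ρ ε`, which is
monotone in `ε` and therefore converges, as `ε → 0+`, to its infimum over `ε > 0`. It is shown that
for every number `m` of output copies there is a threshold `p₀ > 0`, depending only on `m`, with
`S(p₀) ≤ E^(m) ≤ S(2 ^ (-m))`, where `E^(m)` is `distillExponentCopies ρ m`. The left hand side is
at least the infimum of `S` and the right hand side tends to it as `m → ∞`, so `E^(m)` converges to
the same limit. The thresholds need not match: only their positivity, for each fixed `m`, is used.

*From distillation to testing* (`distillExponentCopies_le`). In the Heisenberg picture a channel `Λ`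
turns the test `|Φ⟩⟨Φ|` on the output into a test `N` on the input with
`tr (N X) = ⟨Φ, Λ(X) Φ⟩` (`IsChannel.exists_test`). If `Λ` is non-entangling, then `tr (N σ) ≤ 1 / d`
for all separable `σ`, since a separable state overlaps with a maximally entangled state of Schmidt
rank `d` by at most `1 / d` (`overlap_le_of_mem_separable`), and `d = 2 ^ m` for `m` Bell pairs.
Hence `1 - N` is a test against every separable state with error at most `2 ^ (-m)`, and its value
on `ρ^{⊗ n}` is the infidelity of the protocol.

*From testing to distillation* (`exists_le_distillExponentCopies`). The quantity `hypoTestSep`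
provides a test for each separable state individually. A single test good for all of them is
obtained from the finite dimensional minimax theorem, applied to finitely many product vectors at a
time, and weak operator compactness of the set of tests (`exists_universal_test`). Given such a test
`M`, the channel `X ↦ tr ((1 - M) X) Φ + tr (M X) τ` (`measurePrepare`) prepares `Φ` from `ρ^{⊗ n}`
up to the error `tr (M ρ^{⊗ n})`, and maps a separable state to a mixture of `Φ` and `τ` in which
`Φ` has weight at most `p₀`. It is non-entangling if `τ` is a separable state such that these
mixtures remain separable (`exists_mix_mem_convexHull`).

Both directions rest on the theory of trace class operators for the trace norm `tr √(X X†)`. It is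
developed from the factorization of a trace class operator into two Hilbert–Schmidt operators
(`exists_eq_mul_hsSq_le`): for products of two Hilbert–Schmidt operators, the independence of the
trace from the basis, its cyclicity, and the bound `|tr (A B)| ≤ ‖A‖₂ ‖B‖₂` follow from Parseval's
identity and absolute convergence. That bounded functionals on the trace class are given by bounded
operators (`exists_eq_trace_mul`) is what the Heisenberg picture needs.
-/

noncomputable section

namespace EntTest

universe u v

/-! ### Hilbert–Schmidt operators -/

section TraceTheory

variable {H : Type*} [NormedAddCommGroup H] [InnerProductSpace ℂ H]

/-- Parseval's identity in `[0, ∞]`. -/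
theorem tsum_enorm_inner_sq {ι : Type*} (e : HilbertBasis ι ℂ H) (x : H) :
    ∑' i, ‖⟪e i, x⟫_ℂ‖ₑ ^ 2 = ‖x‖ₑ ^ 2 := by
  have h := (e.hasSum_inner_mul_inner x x).mapL Complex.reCLM
  have h1 : (fun i => Complex.reCLM (⟪x, e i⟫_ℂ * ⟪e i, x⟫_ℂ)) = fun i => ‖⟪e i, x⟫_ℂ‖ ^ 2 := by
    funext i
    rw [← inner_conj_symm, mul_comm, RCLike.mul_conj]
    simp [← Complex.ofReal_pow]
  rw [h1] at h
  have h2 : Complex.reCLM ⟪x, x⟫_ℂ = ‖x‖ ^ 2 := by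
    simp [inner_self_eq_norm_sq_to_K, ← Complex.ofReal_pow]
  rw [h2] at h
  calc ∑' i, ‖⟪e i, x⟫_ℂ‖ₑ ^ 2 = ∑' i, ENNReal.ofReal (‖⟪e i, x⟫_ℂ‖ ^ 2) := by
        simp_rw [ENNReal.ofReal_pow (norm_nonneg _), ofReal_norm]
    _ = ENNReal.ofReal (‖x‖ ^ 2) := by
        rw [← h.tsum_eq, ENNReal.ofReal_tsum_of_nonneg (fun _ => by positivity) h.summable]
    _ = ‖x‖ₑ ^ 2 := by rw [ENNReal.ofReal_pow (norm_nonneg _), ofReal_norm]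

variable [CompleteSpace H]

theorem tsum_enorm_apply_sq_eq_star {ι κ : Type*} (e : HilbertBasis ι ℂ H)
    (f : HilbertBasis κ ℂ H) (T : H →L[ℂ] H) :
    ∑' i, ‖T (e i)‖ₑ ^ 2 = ∑' j, ‖(star T) (f j)‖ₑ ^ 2 := by
  simp_rw [← tsum_enorm_inner_sq f (T _), ← tsum_enorm_inner_sq e ((star T) _)]
  rw [ENNReal.tsum_comm]
  refine tsum_congr fun j => tsum_congr fun i => ?_
  rw [ContinuousLinearMap.star_eq_adjoint, ContinuousLinearMap.adjoint_inner_right,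
    ← inner_conj_symm, RCLike.enorm_conj]

/-- The squared Hilbert–Schmidt norm `∑ i, ‖T (e i)‖²`, with value `∞` if `T` is not a
Hilbert–Schmidt operator. -/
def hsSq (T : H →L[ℂ] H) : ℝ≥0∞ := ∑' i, ‖T (onb H i)‖ₑ ^ 2

theorem hsSq_star (T : H →L[ℂ] H) : hsSq (star T) = hsSq T :=
  (tsum_enorm_apply_sq_eq_star (onb H) (onb H) T).symm

theorem hsSq_eq_tsum {ι : Type*} (e : HilbertBasis ι ℂ H) (T : H →L[ℂ] H) :
    hsSq T = ∑' i, ‖T (e i)‖ₑ ^ 2 := by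
  rw [tsum_enorm_apply_sq_eq_star e (onb H), ← hsSq_star, hsSq]

theorem hsSq_mul_le_left (U T : H →L[ℂ] H) : hsSq (U * T) ≤ ‖U‖ₑ ^ 2 * hsSq T := by
  rw [hsSq, hsSq, ← ENNReal.tsum_mul_left]
  refine ENNReal.tsum_le_tsum fun i => ?_
  rw [← mul_pow]
  gcongr
  exact U.le_opENorm _

theorem hsSq_mul_le_right (T U : H →L[ℂ] H) : hsSq (T * U) ≤ ‖U‖ₑ ^ 2 * hsSq T := by
  rw [← hsSq_star, ← hsSq_star T, star_mul]
  refine (hsSq_mul_le_left _ _).trans_eq ?_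
  rw [← ofReal_norm, norm_star, ofReal_norm]

theorem enorm_sq_le_hsSq (T : H →L[ℂ] H) : ‖T‖ₑ ^ 2 ≤ hsSq T := by
  by_cases hT : hsSq T = ⊤
  · simp [hT]
  rw [← hsSq_star] at hT ⊢
  have key : ∀ x, ‖T x‖ ≤ √(hsSq (star T)).toReal * ‖x‖ := by
    intro x
    have h : ‖T x‖ₑ ^ 2 ≤ hsSq (star T) * ‖x‖ₑ ^ 2 := by
      rw [← tsum_enorm_inner_sq (onb H), hsSq, ← ENNReal.tsum_mul_right]
      refine ENNReal.tsum_le_tsum fun i => ?_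
      rw [← mul_pow, ← ContinuousLinearMap.adjoint_inner_left,
        ← ContinuousLinearMap.star_eq_adjoint]
      gcongr
      rw [← ofReal_norm, ← ofReal_norm, ← ofReal_norm, ← ENNReal.ofReal_mul (norm_nonneg _)]
      exact ENNReal.ofReal_le_ofReal (norm_inner_le_norm _ _)
    have h2 := ENNReal.toReal_mono (by finiteness) h
    rw [ENNReal.toReal_mul] at h2
    simp only [ENNReal.toReal_pow, toReal_enorm] at h2
    have := Real.sqrt_le_sqrt h2
    rwa [Real.sqrt_sq (norm_nonneg _), Real.sqrt_mul (by positivity),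
      Real.sqrt_sq (norm_nonneg _)] at this
  have h1 := T.opNorm_le_bound (Real.sqrt_nonneg _) key
  have h2 : ‖T‖ ^ 2 ≤ (hsSq (star T)).toReal := by
    calc ‖T‖ ^ 2 ≤ √(hsSq (star T)).toReal ^ 2 := by gcongr
      _ = _ := Real.sq_sqrt (by positivity)
  rw [← ofReal_norm, ← ENNReal.ofReal_pow (norm_nonneg _)]
  exact ENNReal.ofReal_le_of_le_toReal h2

theorem inner_star_mul_self (S : H →L[ℂ] H) (x : H) :
    ⟪x, (star S * S) x⟫_ℂ = ((‖S x‖ ^ 2 : ℝ) : ℂ) := by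
  rw [mul_apply_eq_comp, ContinuousLinearMap.star_eq_adjoint,
    ContinuousLinearMap.adjoint_inner_right, inner_self_eq_norm_sq_to_K]
  simp

theorem ofReal_re_inner_star_mul_self (S : H →L[ℂ] H) (x : H) :
    ENNReal.ofReal (⟪x, (star S * S) x⟫_ℂ).re = ‖S x‖ₑ ^ 2 := by
  rw [inner_star_mul_self, Complex.ofReal_re, ENNReal.ofReal_pow (norm_nonneg _), ofReal_norm]

theorem posTrace_star_mul_self (S : H →L[ℂ] H) : posTrace (star S * S) = hsSq S :=
  tsum_congr fun _ => ofReal_re_inner_star_mul_self _ _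

theorem star_sqrt (P : H →L[ℂ] H) : star (CFC.sqrt P) = CFC.sqrt P :=
  (IsSelfAdjoint.of_nonneg (CFC.sqrt_nonneg P)).star_eq

theorem star_sqrt_mul_sqrt {P : H →L[ℂ] H} (hP : 0 ≤ P) :
    star (CFC.sqrt P) * CFC.sqrt P = P := by
  rw [star_sqrt, CFC.sqrt_mul_sqrt_self P hP]

theorem hsSq_sqrt {P : H →L[ℂ] H} (hP : 0 ≤ P) : hsSq (CFC.sqrt P) = posTrace P := by
  rw [← posTrace_star_mul_self, star_sqrt_mul_sqrt hP]

theorem posTrace_eq_tsum {ι : Type*} (e : HilbertBasis ι ℂ H) {P : H →L[ℂ] H} (hP : 0 ≤ P) :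
    posTrace P = ∑' i, ENNReal.ofReal (⟪e i, P (e i)⟫_ℂ).re := by
  rw [← hsSq_sqrt hP, hsSq_eq_tsum e]
  refine tsum_congr fun i => ?_
  rw [← ofReal_re_inner_star_mul_self, star_sqrt_mul_sqrt hP]

/-- The absolutely convergent double series behind the cyclicity of the trace. -/
theorem summable_inner_mul_inner_of_hsSq {ι κ : Type*} (e : HilbertBasis ι ℂ H)
    (f : HilbertBasis κ ℂ H) {A B : H →L[ℂ] H} (hA : hsSq A < ⊤) (hB : hsSq B < ⊤) :
    Summable fun p : ι × κ => ⟪e p.1, A (f p.2)⟫_ℂ * ⟪f p.2, B (e p.1)⟫_ℂ := by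
  have h1 : Summable fun p : ι × κ => ‖⟪e p.1, A (f p.2)⟫_ℂ‖ ^ 2 := by
    have : ∑' p : ι × κ, ‖⟪e p.1, A (f p.2)⟫_ℂ‖ₑ ^ 2 = hsSq A := by
      rw [ENNReal.tsum_prod (f := fun i j => ‖⟪e i, A (f j)⟫_ℂ‖ₑ ^ 2), ENNReal.tsum_comm,
        hsSq_eq_tsum f]
      exact tsum_congr fun j => tsum_enorm_inner_sq e _
    have h := ENNReal.summable_toReal (this ▸ hA.ne)
    simpa using h
  have h2 : Summable fun p : ι × κ => ‖⟪f p.2, B (e p.1)⟫_ℂ‖ ^ 2 := by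
    have : ∑' p : ι × κ, ‖⟪f p.2, B (e p.1)⟫_ℂ‖ₑ ^ 2 = hsSq B := by
      rw [ENNReal.tsum_prod (f := fun i j => ‖⟪f j, B (e i)⟫_ℂ‖ₑ ^ 2), hsSq_eq_tsum e]
      exact tsum_congr fun j => tsum_enorm_inner_sq f _
    have h := ENNReal.summable_toReal (this ▸ hB.ne)
    simpa using h
  refine Summable.of_norm_bounded (h1.add h2) fun p => ?_
  rw [norm_mul]
  nlinarith [sq_nonneg (‖⟪e p.1, A (f p.2)⟫_ℂ‖ - ‖⟪f p.2, B (e p.1)⟫_ℂ‖),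
    sq_nonneg ‖⟪e p.1, A (f p.2)⟫_ℂ‖, sq_nonneg ‖⟪f p.2, B (e p.1)⟫_ℂ‖]

/-- The trace of `A B` may be computed in any basis and equals the trace of `B A`: both are the sum
of the same absolutely convergent double series. -/
theorem hasSum_inner_mul_of_hsSq' {ι : Type*} (e : HilbertBasis ι ℂ H)
    {A B : H →L[ℂ] H} (hA : hsSq A < ⊤) (hB : hsSq B < ⊤) :
    HasSum (fun i => ⟪e i, (A * B) (e i)⟫_ℂ) (trace (B * A)) := by
  have hs := summable_inner_mul_inner_of_hsSq e (onb H) hA hB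
  have h1 := hs.hasSum.prod_fiberwise (g := fun i => ⟪e i, (A * B) (e i)⟫_ℂ) fun i => by
    have := (onb H).hasSum_inner_mul_inner ((star A) (e i)) (B (e i))
    simpa only [ContinuousLinearMap.star_eq_adjoint, ContinuousLinearMap.adjoint_inner_left]
      using! this
  have h2 := ((Equiv.prodComm _ _).hasSum_iff.2 hs.hasSum).prod_fiberwise
    (g := fun j => ⟪onb H j, (B * A) (onb H j)⟫_ℂ) fun j => by
    have := e.hasSum_inner_mul_inner ((star B) (onb H j)) (A (onb H j))
    simp only [ContinuousLinearMap.star_eq_adjoint, ContinuousLinearMap.adjoint_inner_left] at this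
    convert! this using 2 with i
    exact mul_comm _ _
  rwa [trace, h2.tsum_eq]

theorem trace_mul_comm_of_hsSq {A B : H →L[ℂ] H} (hA : hsSq A < ⊤) (hB : hsSq B < ⊤) :
    trace (A * B) = trace (B * A) :=
  (hasSum_inner_mul_of_hsSq' (onb H) hA hB).tsum_eq

theorem hasSum_inner_mul_of_hsSq {ι : Type*} (e : HilbertBasis ι ℂ H)
    {A B : H →L[ℂ] H} (hA : hsSq A < ⊤) (hB : hsSq B < ⊤) :
    HasSum (fun i => ⟪e i, (A * B) (e i)⟫_ℂ) (trace (A * B)) :=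
  trace_mul_comm_of_hsSq hA hB ▸ hasSum_inner_mul_of_hsSq' e hA hB

theorem sum_norm_sq_le_hsSq {T : H →L[ℂ] H} (hT : hsSq T < ⊤) (s : Finset (BasisIndex H)) :
    ∑ i ∈ s, ‖T (onb H i)‖ ^ 2 ≤ (hsSq T).toReal := by
  have h := ENNReal.sum_le_tsum (f := fun i => ‖T (onb H i)‖ₑ ^ 2) s
  have h2 := ENNReal.toReal_mono hT.ne h
  rwa [ENNReal.toReal_sum (fun i _ => by finiteness), Finset.sum_congr rfl (g := fun i =>
    ‖T (onb H i)‖ ^ 2) (fun i _ => by simp)] at h2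

theorem norm_trace_mul_le_of_hsSq {A B : H →L[ℂ] H} (hA : hsSq A < ⊤) (hB : hsSq B < ⊤) :
    ‖trace (A * B)‖ ≤ √(hsSq A).toReal * √(hsSq B).toReal := by
  refine le_of_tendsto (hasSum_inner_mul_of_hsSq (onb H) hA hB).norm (.of_forall fun s => ?_)
  have hA' : hsSq (star A) < ⊤ := by rwa [hsSq_star]
  calc ‖∑ i ∈ s, ⟪onb H i, (A * B) (onb H i)⟫_ℂ‖
      ≤ ∑ i ∈ s, ‖(star A) (onb H i)‖ * ‖B (onb H i)‖ := by
        refine norm_sum_le_of_le _ fun i _ => ?_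
        rw [mul_apply_eq_comp, ← ContinuousLinearMap.adjoint_inner_left,
          ← ContinuousLinearMap.star_eq_adjoint]
        exact norm_inner_le_norm _ _
    _ ≤ √(∑ i ∈ s, ‖(star A) (onb H i)‖ ^ 2) * √(∑ i ∈ s, ‖B (onb H i)‖ ^ 2) :=
        Real.sum_mul_le_sqrt_mul_sqrt _ _ _
    _ ≤ _ := by
        rw [← hsSq_star A]
        gcongr
        · exact sum_norm_sq_le_hsSq hA' s
        · exact sum_norm_sq_le_hsSq hB s

/-- A form of the factorization lemma of Douglas: the map `T v ↦ X v` is a well-defined contraction,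
which extends to the closure of the range of `T`, and by zero to its orthogonal complement. -/
theorem exists_eq_mul_of_norm_apply_le {X T : H →L[ℂ] H} (h : ∀ v, ‖X v‖ ≤ ‖T v‖) :
    ∃ W : H →L[ℂ] H, ‖W‖ ≤ 1 ∧ X = W * T := by
  let R : Submodule ℂ H := (LinearMap.range T.toLinearMap).topologicalClosure
  have hcl : IsClosed (R : Set H) := Submodule.isClosed_topologicalClosure _
  have : CompleteSpace R := hcl.completeSpace_coe
  have hmem : ∀ v, T v ∈ R := fun v => Submodule.le_topologicalClosure _ ⟨v, rfl⟩
  let e : H →ₗ[ℂ] R := T.toLinearMap.codRestrict R hmem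
  have hd : DenseRange e := by
    intro x
    rw [closure_subtype]
    have : Subtype.val '' Set.range e = Set.range T := by
      rw [← Set.range_comp]; rfl
    rw [this]
    exact x.2
  have hn : ∀ v, ‖X.toLinearMap v‖ ≤ 1 * ‖e v‖ := fun v => by simpa using! h v
  let V : R →L[ℂ] H := X.toLinearMap.extendOfNorm e
  refine ⟨V ∘L R.orthogonalProjectionOnto, ?_, ?_⟩
  · refine (ContinuousLinearMap.opNorm_comp_le _ _).trans ?_
    calc ‖V‖ * ‖R.orthogonalProjectionOnto‖ ≤ 1 * 1 := by
          gcongr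
          · exact LinearMap.opNorm_extendOfNorm_le hd zero_le_one hn
          · exact Submodule.orthogonalProjectionOnto_norm_le R
      _ = 1 := one_mul 1
  · ext v
    have h1 : R.orthogonalProjectionOnto (T v) = e v :=
      Submodule.orthogonalProjectionOnto_mem_subspace_eq_self (e v)
    change X v = V (R.orthogonalProjectionOnto (T v))
    rw [h1]
    exact (LinearMap.extendOfNorm_eq hd ⟨1, hn⟩ v).symm

/-- The operators `√(X X†)` and `X†` have the same quadratic form `v ↦ ‖· v‖ ^ 2`, so that by
`exists_eq_mul_of_norm_apply_le` each is a contraction times the other. This replaces the polar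
decomposition. -/
theorem norm_sqrt_mul_star_apply (X : H →L[ℂ] H) (v : H) :
    ‖CFC.sqrt (X * star X) v‖ = ‖(star X) v‖ := by
  have h := inner_star_mul_self (CFC.sqrt (X * star X)) v
  rw [star_sqrt_mul_sqrt (mul_star_self_nonneg X)] at h
  have h2 := inner_star_mul_self (star X) v
  rw [star_star, h] at h2
  exact (sq_eq_sq₀ (norm_nonneg _) (norm_nonneg _)).1 (Complex.ofReal_injective h2)

theorem exists_eq_sqrt_mul (X : H →L[ℂ] H) :
    ∃ W : H →L[ℂ] H, ‖W‖ ≤ 1 ∧ X = CFC.sqrt (X * star X) * W := by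
  obtain ⟨W, hW, h⟩ := exists_eq_mul_of_norm_apply_le
    (fun v => (norm_sqrt_mul_star_apply X v).ge)
  refine ⟨star W, by rwa [norm_star], ?_⟩
  have := congrArg star h
  rwa [star_star, star_mul, star_sqrt] at this

theorem exists_sqrt_eq_mul (X : H →L[ℂ] H) :
    ∃ W : H →L[ℂ] H, ‖W‖ ≤ 1 ∧ CFC.sqrt (X * star X) = X * W := by
  obtain ⟨W, hW, h⟩ := exists_eq_mul_of_norm_apply_le
    (fun v => (norm_sqrt_mul_star_apply X v).le)
  refine ⟨star W, by rwa [norm_star], ?_⟩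
  have := congrArg star h
  rwa [star_mul, star_star, star_sqrt] at this

end TraceTheory

/-! ### The trace class -/

section TraceClass

variable {H : Type*} [NormedAddCommGroup H] [InnerProductSpace ℂ H] [CompleteSpace H]

theorem hsSq_mul_right_lt_top {T : H →L[ℂ] H} (hT : hsSq T < ⊤) (U : H →L[ℂ] H) :
    hsSq (T * U) < ⊤ :=
  (hsSq_mul_le_right T U).trans_lt (by finiteness)

theorem hsSq_mul_left_lt_top {T : H →L[ℂ] H} (hT : hsSq T < ⊤) (U : H →L[ℂ] H) :
    hsSq (U * T) < ⊤ :=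
  (hsSq_mul_le_left U T).trans_lt (by finiteness)

theorem hsSq_mul_le_of_norm_le_one (T : H →L[ℂ] H) {W : H →L[ℂ] H} (hW : ‖W‖ ≤ 1) :
    hsSq (T * W) ≤ hsSq T := by
  refine (hsSq_mul_le_right _ _).trans (mul_le_of_le_one_left (by positivity) ?_)
  rw [← ofReal_norm]
  exact pow_le_one₀ (by positivity) (ENNReal.ofReal_le_one.2 hW)

theorem inner_re_eq_of_nonneg {P : H →L[ℂ] H} (hP : 0 ≤ P) (x : H) :
    (((⟪x, P x⟫_ℂ).re : ℝ) : ℂ) = ⟪x, P x⟫_ℂ := by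
  rw [← star_sqrt_mul_sqrt hP, inner_star_mul_self, Complex.ofReal_re]

theorem re_inner_nonneg {P : H →L[ℂ] H} (hP : 0 ≤ P) (x : H) : 0 ≤ (⟪x, P x⟫_ℂ).re := by
  rw [← star_sqrt_mul_sqrt hP, inner_star_mul_self, Complex.ofReal_re]
  positivity

/-- For a positive operator the two notions of trace agree. -/
theorem posTrace_eq_ofReal_of_hasSum {P : H →L[ℂ] H} (hP : 0 ≤ P) {c : ℂ}
    (h : HasSum (fun i => ⟪onb H i, P (onb H i)⟫_ℂ) c) : posTrace P = ENNReal.ofReal c.re := by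
  have h1 : HasSum (fun i => (⟪onb H i, P (onb H i)⟫_ℂ).re) c.re := h.mapL Complex.reCLM
  rw [posTrace, ← h1.tsum_eq, ENNReal.ofReal_tsum_of_nonneg (fun i => re_inner_nonneg hP _)
    h1.summable]

/-- Every `X` is a product of two operators whose squared Hilbert–Schmidt norms are at most the
trace norm of `X`. With a contraction `W` such that `X = √(X X†) W`, the factors are
`(X X†)^{1/4}` and `(X X†)^{1/4} W`. -/
theorem exists_eq_mul_hsSq_le (X : H →L[ℂ] H) :
    ∃ A B : H →L[ℂ] H, X = A * B ∧ hsSq A ≤ traceNorm X ∧ hsSq B ≤ traceNorm X := by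
  obtain ⟨W, hW, h⟩ := exists_eq_sqrt_mul X
  set T := CFC.sqrt (X * star X) with hT
  have hT0 : 0 ≤ T := CFC.sqrt_nonneg _
  have hS : hsSq (CFC.sqrt T) = traceNorm X := hsSq_sqrt hT0
  refine ⟨CFC.sqrt T, CFC.sqrt T * W, ?_, hS.le, ?_⟩
  · rw [← mul_assoc, CFC.sqrt_mul_sqrt_self T hT0, ← h]
  · exact hS ▸ hsSq_mul_le_of_norm_le_one _ hW

theorem IsTraceClass.hasSum_mul_left {ι : Type*} (e : HilbertBasis ι ℂ H) {X : H →L[ℂ] H}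
    (hX : IsTraceClass X) (M : H →L[ℂ] H) :
    HasSum (fun i => ⟪e i, (M * X) (e i)⟫_ℂ) (trace (M * X)) := by
  obtain ⟨A, B, rfl, hA, hB⟩ := exists_eq_mul_hsSq_le X
  rw [← mul_assoc]
  exact hasSum_inner_mul_of_hsSq e (hsSq_mul_left_lt_top (hA.trans_lt hX) M) (hB.trans_lt hX)

theorem IsTraceClass.trace_mul_comm {X : H →L[ℂ] H} (hX : IsTraceClass X) (M : H →L[ℂ] H) :
    trace (M * X) = trace (X * M) := by
  obtain ⟨A, B, rfl, hA, hB⟩ := exists_eq_mul_hsSq_le X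
  have hA' := hA.trans_lt hX
  have hB' := hB.trans_lt hX
  rw [← mul_assoc, trace_mul_comm_of_hsSq (hsSq_mul_left_lt_top hA' M) hB', mul_assoc,
    ← mul_assoc, trace_mul_comm_of_hsSq (hsSq_mul_right_lt_top hB' M) hA']

theorem IsTraceClass.hasSum_mul_right {ι : Type*} (e : HilbertBasis ι ℂ H) {X : H →L[ℂ] H}
    (hX : IsTraceClass X) (M : H →L[ℂ] H) :
    HasSum (fun i => ⟪e i, (X * M) (e i)⟫_ℂ) (trace (X * M)) := by
  obtain ⟨A, B, rfl, hA, hB⟩ := exists_eq_mul_hsSq_le X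
  rw [mul_assoc]
  exact hasSum_inner_mul_of_hsSq e (hA.trans_lt hX) (hsSq_mul_right_lt_top (hB.trans_lt hX) M)

theorem IsTraceClass.hasSum {ι : Type*} (e : HilbertBasis ι ℂ H) {X : H →L[ℂ] H}
    (hX : IsTraceClass X) : HasSum (fun i => ⟪e i, X (e i)⟫_ℂ) (trace X) := by
  simpa using hX.hasSum_mul_left e 1

theorem sqrt_toReal_mul_sqrt_toReal_le {a b : ℝ≥0∞} {c : ℝ≥0∞} (hc : c < ⊤) {t : ℝ≥0∞} (ht : t < ⊤)
    (ha : a ≤ c) (hb : b ≤ t * c) :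
    √a.toReal * √b.toReal ≤ √t.toReal * c.toReal := by
  have h1 := ENNReal.toReal_mono hc.ne ha
  have h2 := ENNReal.toReal_mono (by finiteness) hb
  rw [ENNReal.toReal_mul] at h2
  calc √a.toReal * √b.toReal ≤ √c.toReal * √(t.toReal * c.toReal) := by gcongr
    _ = √t.toReal * (√c.toReal * √c.toReal) := by
        rw [Real.sqrt_mul (by positivity)]; ring
    _ = _ := by rw [Real.mul_self_sqrt (by positivity)]

theorem IsTraceClass.norm_trace_mul_right_le {X : H →L[ℂ] H} (hX : IsTraceClass X)
    (M : H →L[ℂ] H) : ‖trace (X * M)‖ ≤ ‖M‖ * (traceNorm X).toReal := by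
  obtain ⟨A, B, hAB, hA, hB⟩ := exists_eq_mul_hsSq_le X
  have h := norm_trace_mul_le_of_hsSq (hA.trans_lt hX) (hsSq_mul_right_lt_top (hB.trans_lt hX) M)
  rw [← mul_assoc, ← hAB] at h
  refine h.trans ((sqrt_toReal_mul_sqrt_toReal_le hX (t := ‖M‖ₑ ^ 2) (by finiteness) hA
    ((hsSq_mul_le_right B M).trans (by gcongr))).trans_eq ?_)
  simp

theorem IsTraceClass.norm_trace_mul_left_le {X : H →L[ℂ] H} (hX : IsTraceClass X)
    (M : H →L[ℂ] H) : ‖trace (M * X)‖ ≤ ‖M‖ * (traceNorm X).toReal :=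
  hX.trace_mul_comm M ▸ hX.norm_trace_mul_right_le M

/-- The trace norm is the trace of `X W` for some contraction `W`. -/
theorem exists_traceNorm_eq (X : H →L[ℂ] H) : ∃ W : H →L[ℂ] H, ‖W‖ ≤ 1 ∧
    ∀ c, HasSum (fun i => ⟪onb H i, (X * W) (onb H i)⟫_ℂ) c →
      traceNorm X = ENNReal.ofReal c.re := by
  obtain ⟨W, hW, h⟩ := exists_sqrt_eq_mul X
  have h0 : 0 ≤ X * W := by
    rw [← h]
    exact CFC.sqrt_nonneg _
  refine ⟨W, hW, fun c hc => ?_⟩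
  rw [traceNorm, h]
  exact posTrace_eq_ofReal_of_hasSum h0 hc

/-- Hölder's inequality `‖A B‖₁ ≤ ‖A‖₂ ‖B‖₂`. -/
theorem traceNorm_mul_le {A B : H →L[ℂ] H} (hA : hsSq A < ⊤) (hB : hsSq B < ⊤) :
    traceNorm (A * B) ≤ ENNReal.ofReal (√(hsSq A).toReal * √(hsSq B).toReal) := by
  obtain ⟨W, hW, h⟩ := exists_traceNorm_eq (A * B)
  have hBW := hsSq_mul_right_lt_top hB W
  rw [mul_assoc] at h
  rw [h _ (hasSum_inner_mul_of_hsSq (onb H) hA hBW)]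
  refine ENNReal.ofReal_le_ofReal ((Complex.re_le_norm _).trans
    ((norm_trace_mul_le_of_hsSq hA hBW).trans ?_))
  exact mul_le_mul_of_nonneg_left (Real.sqrt_le_sqrt (ENNReal.toReal_mono hB.ne
    (hsSq_mul_le_of_norm_le_one B hW))) (Real.sqrt_nonneg _)

theorem isTraceClass_mul {A B : H →L[ℂ] H} (hA : hsSq A < ⊤) (hB : hsSq B < ⊤) :
    IsTraceClass (A * B) :=
  (traceNorm_mul_le hA hB).trans_lt ENNReal.ofReal_lt_top

/-- The triangle inequality: with a contraction `W` such that `‖X + Y‖₁ = tr ((X + Y) W)`, the two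
terms `tr (X W)` and `tr (Y W)` are at most `‖X‖₁` and `‖Y‖₁`. -/
theorem traceNorm_add_le (X Y : H →L[ℂ] H) :
    traceNorm (X + Y) ≤ traceNorm X + traceNorm Y := by
  by_cases hX : IsTraceClass X
  swap
  · simp [not_lt_top_iff.1 hX]
  by_cases hY : IsTraceClass Y
  swap
  · simp [not_lt_top_iff.1 hY]
  obtain ⟨W, hW, h⟩ := exists_traceNorm_eq (X + Y)
  have h1 := (hX.hasSum_mul_right (onb H) W).add (hY.hasSum_mul_right (onb H) W)
  rw [h _ (by simpa only [add_mul, _root_.add_apply, inner_add_right] using h1)]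
  refine ENNReal.ofReal_le_of_le_toReal ?_
  rw [ENNReal.toReal_add hX.ne hY.ne, Complex.add_re]
  refine add_le_add ((Complex.re_le_norm _).trans ((hX.norm_trace_mul_right_le W).trans ?_))
    ((Complex.re_le_norm _).trans ((hY.norm_trace_mul_right_le W).trans ?_)) <;>
  exact mul_le_of_le_one_left (by positivity) hW

theorem traceNorm_smul_le (a : ℂ) (X : H →L[ℂ] H) :
    traceNorm (a • X) ≤ ‖a‖ₑ * traceNorm X := by
  by_cases hX : IsTraceClass X
  swap
  · by_cases ha : a = 0
    · subst ha
      simp [traceNorm, posTrace]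
    · rw [not_lt_top_iff.1 hX, ENNReal.mul_top (by simpa using ha)]
      exact le_top
  obtain ⟨W, hW, h⟩ := exists_traceNorm_eq (a • X)
  have h1 := (hX.hasSum_mul_right (onb H) W).mul_left a
  rw [h _ (by simpa only [smul_mul_assoc, _root_.smul_apply, inner_smul_right]
    using h1)]
  refine ENNReal.ofReal_le_of_le_toReal ?_
  rw [ENNReal.toReal_mul, toReal_enorm]
  refine (Complex.re_le_norm _).trans ?_
  rw [norm_mul]
  gcongr
  exact (hX.norm_trace_mul_right_le W).trans (mul_le_of_le_one_left (by positivity) hW)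

theorem IsTraceClass.add {X Y : H →L[ℂ] H} (hX : IsTraceClass X) (hY : IsTraceClass Y) :
    IsTraceClass (X + Y) :=
  (traceNorm_add_le X Y).trans_lt (ENNReal.add_lt_top.2 ⟨hX, hY⟩)

theorem IsTraceClass.smul {X : H →L[ℂ] H} (hX : IsTraceClass X) (a : ℂ) :
    IsTraceClass (a • X) :=
  (traceNorm_smul_le a X).trans_lt (ENNReal.mul_lt_top (by finiteness) hX)

theorem IsTraceClass.neg {X : H →L[ℂ] H} (hX : IsTraceClass X) : IsTraceClass (-X) := by
  simpa using hX.smul (-1)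

theorem IsTraceClass.sub {X Y : H →L[ℂ] H} (hX : IsTraceClass X) (hY : IsTraceClass Y) :
    IsTraceClass (X - Y) := by
  simpa [sub_eq_add_neg] using hX.add hY.neg

theorem isTraceClass_zero : IsTraceClass (0 : H →L[ℂ] H) := by
  simp [IsTraceClass, traceNorm, posTrace]

theorem isTraceClass_sum {ι : Type*} (s : Finset ι) {X : ι → H →L[ℂ] H}
    (h : ∀ i ∈ s, IsTraceClass (X i)) : IsTraceClass (∑ i ∈ s, X i) := by
  classical
  induction s using Finset.induction_on with
  | empty => simpa using isTraceClass_zero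
  | insert a s ha ih =>
    rw [Finset.sum_insert ha]
    exact (h a (by simp)).add (ih fun i hi => h i (by simp [hi]))

theorem IsTraceClass.mul_left {X : H →L[ℂ] H} (hX : IsTraceClass X) (M : H →L[ℂ] H) :
    IsTraceClass (M * X) := by
  obtain ⟨A, B, rfl, hA, hB⟩ := exists_eq_mul_hsSq_le X
  rw [← mul_assoc]
  exact isTraceClass_mul (hsSq_mul_left_lt_top (hA.trans_lt hX) M) (hB.trans_lt hX)

theorem IsTraceClass.mul_right {X : H →L[ℂ] H} (hX : IsTraceClass X) (M : H →L[ℂ] H) :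
    IsTraceClass (X * M) := by
  obtain ⟨A, B, rfl, hA, hB⟩ := exists_eq_mul_hsSq_le X
  rw [mul_assoc]
  exact isTraceClass_mul (hA.trans_lt hX) (hsSq_mul_right_lt_top (hB.trans_lt hX) M)

theorem IsTraceClass.trace_add {X Y : H →L[ℂ] H} (hX : IsTraceClass X) (hY : IsTraceClass Y) :
    trace (X + Y) = trace X + trace Y := by
  have := (hX.hasSum (onb H)).add (hY.hasSum (onb H))
  simpa only [trace, _root_.add_apply, inner_add_right] using this.tsum_eq

theorem trace_smul (a : ℂ) (X : H →L[ℂ] H) : trace (a • X) = a * trace X := by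
  simp only [trace, _root_.smul_apply, inner_smul_right, tsum_mul_left]

theorem IsTraceClass.trace_sub {X Y : H →L[ℂ] H} (hX : IsTraceClass X) (hY : IsTraceClass Y) :
    trace (X - Y) = trace X - trace Y := by
  have := (hX.hasSum (onb H)).sub (hY.hasSum (onb H))
  simpa only [trace, _root_.sub_apply, inner_sub_right] using this.tsum_eq

theorem trace_sum {ι : Type*} (s : Finset ι) {X : ι → H →L[ℂ] H}
    (h : ∀ i ∈ s, IsTraceClass (X i)) : trace (∑ i ∈ s, X i) = ∑ i ∈ s, trace (X i) := by
  classical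
  induction s using Finset.induction_on with
  | empty => simp [trace]
  | insert a s ha ih =>
    rw [Finset.sum_insert ha, Finset.sum_insert ha, (h a (by simp)).trace_add
      (isTraceClass_sum s fun i hi => h i (by simp [hi])), ih fun i hi => h i (by simp [hi])]

theorem enorm_le_traceNorm (X : H →L[ℂ] H) : ‖X‖ₑ ≤ traceNorm X := by
  by_cases hX : IsTraceClass X
  swap
  · simp [not_lt_top_iff.1 hX]
  obtain ⟨A, B, hAB, hA, hB⟩ := exists_eq_mul_hsSq_le X
  refine (ENNReal.pow_le_pow_left_iff two_ne_zero).1 ?_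
  calc ‖X‖ₑ ^ 2 ≤ (‖A‖ₑ * ‖B‖ₑ) ^ 2 := by
        gcongr
        rw [hAB, ← ofReal_norm, ← ofReal_norm, ← ofReal_norm, ← ENNReal.ofReal_mul (norm_nonneg _)]
        exact ENNReal.ofReal_le_ofReal (norm_mul_le _ _)
    _ = ‖A‖ₑ ^ 2 * ‖B‖ₑ ^ 2 := mul_pow _ _ _
    _ ≤ traceNorm X * traceNorm X := by
        gcongr
        · exact (enorm_sq_le_hsSq A).trans hA
        · exact (enorm_sq_le_hsSq B).trans hB
    _ = traceNorm X ^ 2 := (sq _).symm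

theorem IsTraceClass.norm_le {X : H →L[ℂ] H} (hX : IsTraceClass X) :
    ‖X‖ ≤ (traceNorm X).toReal := by
  simpa using ENNReal.toReal_mono hX.ne (enorm_le_traceNorm X)

theorem traceNorm_of_nonneg {P : H →L[ℂ] H} (hP : 0 ≤ P) : traceNorm P = posTrace P := by
  rw [traceNorm, (IsSelfAdjoint.of_nonneg hP).star_eq, CFC.sqrt_mul_self P hP]

theorem isTraceClass_iff_of_nonneg {P : H →L[ℂ] H} (hP : 0 ≤ P) :
    IsTraceClass P ↔ posTrace P < ⊤ := by
  rw [IsTraceClass, traceNorm_of_nonneg hP]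

theorem IsTraceClass.trace_of_nonneg {P : H →L[ℂ] H} (h : IsTraceClass P) (hP : 0 ≤ P) :
    trace P = ((posTrace P).toReal : ℂ) := by
  have h1 := h.hasSum (onb H)
  rw [posTrace_eq_ofReal_of_hasSum hP h1]
  have h2 : HasSum (fun i => (((⟪onb H i, P (onb H i)⟫_ℂ).re : ℝ) : ℂ)) (trace P) := by
    simpa only [inner_re_eq_of_nonneg hP] using h1
  have h3 : HasSum (fun i => (⟪onb H i, P (onb H i)⟫_ℂ).re) (trace P).re := h1.mapL Complex.reCLM
  rw [ENNReal.toReal_ofReal (h3.nonneg fun i => re_inner_nonneg hP _)]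
  exact h2.unique (Complex.hasSum_ofReal.2 h3)

theorem isState_iff {P : H →L[ℂ] H} : IsState P ↔ 0 ≤ P ∧ posTrace P = 1 := by
  refine ⟨fun ⟨h0, h1, h2⟩ => ⟨h0, ?_⟩, fun ⟨h0, h1⟩ => ?_⟩
  · rw [h1.trace_of_nonneg h0] at h2
    rw [← ENNReal.toReal_eq_one_iff]
    exact_mod_cast h2
  · have h : IsTraceClass P := (isTraceClass_iff_of_nonneg h0).2 (by rw [h1]; simp)
    exact ⟨h0, h, by rw [h.trace_of_nonneg h0, h1]; simp⟩

theorem hsSq_rankOne (x y : H) : hsSq (InnerProductSpace.rankOne ℂ x y) = ‖y‖ₑ ^ 2 * ‖x‖ₑ ^ 2 := by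
  rw [← hsSq_star, hsSq, ← tsum_enorm_inner_sq (onb H) x, ← ENNReal.tsum_mul_left]
  refine tsum_congr fun i => ?_
  rw [ContinuousLinearMap.star_eq_adjoint, InnerProductSpace.adjoint_rankOne,
    InnerProductSpace.rankOne_apply, enorm_smul, mul_pow, mul_comm, ← inner_conj_symm,
    RCLike.enorm_conj]

/-- A factorization of a rank one operator into two rank one operators, the second vector of the
first factor being normalized. It holds for `y = 0` too, as both sides vanish. -/
theorem rankOne_eq_mul (x y : H) : InnerProductSpace.rankOne ℂ x y =
    InnerProductSpace.rankOne ℂ x (((‖y‖⁻¹ : ℝ) : ℂ) • y) *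
      InnerProductSpace.rankOne ℂ (((‖y‖⁻¹ : ℝ) : ℂ) • y) y := by
  by_cases hy : y = 0
  · simp [hy]
  have hu : ⟪((‖y‖⁻¹ : ℝ) : ℂ) • y, ((‖y‖⁻¹ : ℝ) : ℂ) • y⟫_ℂ = 1 := by
    rw [inner_self_eq_norm_sq_to_K, norm_smul]
    simp [hy]
  ext v
  rw [mul_apply_eq_comp, InnerProductSpace.rankOne_apply, InnerProductSpace.rankOne_apply,
    InnerProductSpace.rankOne_apply, inner_smul_right, hu, mul_one]

theorem isTraceClass_rankOne (x y : H) : IsTraceClass (InnerProductSpace.rankOne ℂ x y) := by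
  rw [rankOne_eq_mul]
  refine isTraceClass_mul ?_ ?_ <;>
  · rw [hsSq_rankOne]
    finiteness

theorem trace_mul_rankOne (M : H →L[ℂ] H) (x y : H) :
    trace (M * InnerProductSpace.rankOne ℂ x y) = ⟪y, M x⟫_ℂ := by
  rw [trace, ← (onb H).tsum_inner_mul_inner]
  refine tsum_congr fun i => ?_
  simp

theorem trace_rankOne (x y : H) : trace (InnerProductSpace.rankOne ℂ x y) = ⟪y, x⟫_ℂ := by
  simpa using trace_mul_rankOne 1 x y

end TraceClass

/-! ### Duality, weak compactness and minimax -/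

section Forms

variable {H : Type*} [NormedAddCommGroup H] [InnerProductSpace ℂ H]

theorem nonneg_iff_inner_nonneg {P : H →L[ℂ] H} : 0 ≤ P ↔ ∀ x, 0 ≤ ⟪x, P x⟫_ℂ := by
  rw [ContinuousLinearMap.nonneg_iff_isPositive]
  refine ⟨fun h x => h.inner_nonneg_right x, fun h => ?_⟩
  rw [ContinuousLinearMap.isPositive_iff_complex]
  intro x
  obtain ⟨h2, h3⟩ := Complex.nonneg_iff.1 (h x)
  have hx : ⟪P x, x⟫_ℂ = ⟪x, P x⟫_ℂ := by
    rw [← inner_conj_symm]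
    exact Complex.conj_eq_iff_im.2 h3.symm
  rw [hx]
  exact ⟨Complex.ext rfl h3, h2⟩

variable [CompleteSpace H]

/-- A bounded sesquilinear form is given by a bounded operator. -/
theorem exists_inner_eq_of_form (B : H → H → ℂ) (C : ℝ)
    (add_left : ∀ x x' y, B (x + x') y = B x y + B x' y)
    (smul_left : ∀ (c : ℂ) x y, B (c • x) y = starRingEnd ℂ c * B x y)
    (add_right : ∀ x y y', B x (y + y') = B x y + B x y')
    (smul_right : ∀ (c : ℂ) x y, B x (c • y) = c * B x y)
    (bound : ∀ x y, ‖B x y‖ ≤ C * ‖x‖ * ‖y‖) :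
    ∃ N : H →L[ℂ] H, ∀ x y, ⟪x, N y⟫_ℂ = B x y := by
  let L : H →ₗ⋆[ℂ] H →ₗ[ℂ] ℂ :=
    LinearMap.mk₂'ₛₗ (starRingEnd ℂ) (RingHom.id ℂ) B add_left smul_left add_right smul_right
  let L' : H →L⋆[ℂ] H →L[ℂ] ℂ := L.mkContinuous₂ C bound
  refine ⟨star (InnerProductSpace.continuousLinearMapOfBilin L'), fun x y => ?_⟩
  rw [ContinuousLinearMap.star_eq_adjoint, ContinuousLinearMap.adjoint_inner_right,
    InnerProductSpace.continuousLinearMapOfBilin_apply]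
  rfl

theorem traceNorm_rankOne_le (x y : H) :
    (traceNorm (InnerProductSpace.rankOne ℂ x y)).toReal ≤ ‖x‖ * ‖y‖ := by
  have hlt : ∀ a b : H, hsSq (InnerProductSpace.rankOne ℂ a b) < ⊤ := fun a b => by
    rw [hsSq_rankOne]
    finiteness
  have hsq : ∀ a b : H, √(hsSq (InnerProductSpace.rankOne ℂ a b)).toReal = ‖b‖ * ‖a‖ := by
    intro a b
    rw [hsSq_rankOne, ENNReal.toReal_mul, ENNReal.toReal_pow, ENNReal.toReal_pow, ← mul_pow,
      Real.sqrt_sq (by positivity)]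
    simp
  have hu : ‖((‖y‖⁻¹ : ℝ) : ℂ) • y‖ ≤ 1 := by
    rw [norm_smul]
    by_cases hy : y = 0 <;> simp [hy]
  refine (ENNReal.toReal_mono ENNReal.ofReal_ne_top
    ((congrArg traceNorm (rankOne_eq_mul x y)).le.trans
      (traceNorm_mul_le (hlt _ _) (hlt _ _)))).trans ?_
  rw [ENNReal.toReal_ofReal (by positivity), hsq, hsq]
  calc _ ≤ 1 * ‖x‖ * (‖y‖ * 1) := by gcongr
    _ = _ := by ring

/-- The squared Hilbert–Schmidt norm of `A` cut off to finitely many basis vectors is the tail of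
the series defining `hsSq A`. -/
theorem hsSq_mul_one_sub_sum (A : H →L[ℂ] H) (s : Finset (BasisIndex H)) :
    hsSq (A * (1 - ∑ i ∈ s, ketbra (onb H i))) =
      ∑' i : {i // i ∉ s}, ‖A (onb H i)‖ₑ ^ 2 := by
  classical
  have horth := orthonormal_iff_ite.1 (onb H).orthonormal
  have h : ∀ j, (A * (1 - ∑ i ∈ s, ketbra (onb H i))) (onb H j) =
      if j ∈ s then 0 else A (onb H j) := by
    intro j
    rw [mul_apply_eq_comp, _root_.sub_apply, _root_.sum_apply]
    have : ∑ i ∈ s, ketbra (onb H i) (onb H j) = if j ∈ s then onb H j else 0 := by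
      simp_rw [ketbra, InnerProductSpace.rankOne_apply, horth, ite_smul, one_smul, zero_smul]
      rw [Finset.sum_ite_eq']
    rw [this]
    split_ifs <;> simp
  rw [hsSq]
  simp_rw [h]
  rw [← tsum_subtype_eq_of_support_subset (s := {i | i ∉ s})]
  · exact tsum_congr fun i => by rw [if_neg i.2]
  · intro i hi his
    simp [his] at hi

/-- Bounded functionals on the trace class are given by bounded operators. The values of `f` on rank
one operators form a bounded sesquilinear form, which defines `N`; the finite rank operators
`∑ i ∈ s, A |e i⟩⟨e i| B` approximate `X = A B` in trace norm. -/
theorem exists_eq_trace_mul (f : (H →L[ℂ] H) → ℂ) (C : ℝ) (hC : 0 ≤ C)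
    (hadd : ∀ X Y, IsTraceClass X → IsTraceClass Y → f (X + Y) = f X + f Y)
    (hsmul : ∀ (c : ℂ) X, IsTraceClass X → f (c • X) = c * f X)
    (hbound : ∀ X, IsTraceClass X → ‖f X‖ ≤ C * (traceNorm X).toReal) :
    ∃ N : H →L[ℂ] H, ∀ X, IsTraceClass X → f X = trace (N * X) := by
  have hr := @isTraceClass_rankOne H _ _ _
  obtain ⟨N, hN⟩ := exists_inner_eq_of_form
    (fun y x => f (InnerProductSpace.rankOne ℂ x y)) C
    (fun y y' x => by rw [map_add, hadd _ _ (hr _ _) (hr _ _)])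
    (fun c y x => by rw [map_smulₛₗ, hsmul _ _ (hr _ _)])
    (fun y x x' => by rw [map_add, _root_.add_apply, hadd _ _ (hr _ _) (hr _ _)])
    (fun c y x => by rw [map_smul, _root_.smul_apply, hsmul _ _ (hr _ _)])
    (fun y x => (hbound _ (hr _ _)).trans (by
      have := mul_le_mul_of_nonneg_left (traceNorm_rankOne_le x y) hC
      linarith))
  have hf0 : f 0 = 0 := by simpa using hsmul 0 0 isTraceClass_zero
  have hfsum : ∀ (s : Finset (BasisIndex H)) (Y : BasisIndex H → H →L[ℂ] H),
      (∀ i, IsTraceClass (Y i)) → f (∑ i ∈ s, Y i) = ∑ i ∈ s, f (Y i) := by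
    classical
    intro s Y hY
    induction s using Finset.induction_on with
    | empty => simpa using hf0
    | insert a s ha ih =>
      rw [Finset.sum_insert ha, Finset.sum_insert ha, hadd _ _ (hY a)
        (isTraceClass_sum s fun i _ => hY i), ih]
  refine ⟨N, fun X hX => ?_⟩
  obtain ⟨A, B, hAB, hA, hB⟩ := exists_eq_mul_hsSq_le X
  have hA' := hA.trans_lt hX
  have hB' := hB.trans_lt hX
  have key : trace (N * X) = trace (B * (N * A)) := by
    rw [hAB, ← mul_assoc, trace_mul_comm_of_hsSq (hsSq_mul_left_lt_top hA' N) hB']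
  have hsum := hasSum_inner_mul_of_hsSq (onb H) hB' (hsSq_mul_left_lt_top hA' N)
  rw [← key] at hsum
  -- the terms of the finite rank truncations of `X = A B`
  let Y : BasisIndex H → H →L[ℂ] H := fun i =>
    InnerProductSpace.rankOne ℂ (A (onb H i)) (star B (onb H i))
  have hY : ∀ i, IsTraceClass (Y i) := fun i => hr _ _
  have hfY : ∀ i, f (Y i) = ⟪onb H i, (B * (N * A)) (onb H i)⟫_ℂ := by
    intro i
    rw [mul_apply_eq_comp, mul_apply_eq_comp, ← ContinuousLinearMap.adjoint_inner_left, hN,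
      ← ContinuousLinearMap.star_eq_adjoint]
  have hsub : ∀ s : Finset (BasisIndex H), X - ∑ i ∈ s, Y i =
      (A * (1 - ∑ i ∈ s, ketbra (onb H i))) * B := by
    intro s
    rw [mul_sub, sub_mul, mul_one, ← hAB, Finset.mul_sum, Finset.sum_mul]
    congr 1
    refine Finset.sum_congr rfl fun i _ => ?_
    ext v
    simp [Y, ketbra, ContinuousLinearMap.star_eq_adjoint, ContinuousLinearMap.adjoint_inner_left]
  have hlim : Tendsto (fun s : Finset (BasisIndex H) => f X - ∑ i ∈ s, f (Y i)) atTop (𝓝 0) := by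
    have h1 : Tendsto (fun s : Finset (BasisIndex H) =>
        C * (√(∑' i : {i // i ∉ s}, ‖A (onb H i)‖ₑ ^ 2).toReal * √(hsSq B).toReal)) atTop
        (𝓝 (C * (√(0 : ℝ≥0∞).toReal * √(hsSq B).toReal))) := by
      refine Tendsto.const_mul _ (Tendsto.mul_const _ ?_)
      exact (Real.continuous_sqrt.tendsto _).comp ((ENNReal.tendsto_toReal (by simp)).comp
        (ENNReal.tendsto_tsum_compl_atTop_zero hA'.ne))
    simp only [ENNReal.toReal_zero, Real.sqrt_zero, zero_mul, mul_zero] at h1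
    refine squeeze_zero_norm (fun s => ?_) h1
    have hs := isTraceClass_sum s fun i _ => hY i
    have h2 : f X - ∑ i ∈ s, f (Y i) = f (X - ∑ i ∈ s, Y i) := by
      rw [← hfsum s Y hY, sub_eq_iff_eq_add, ← hadd _ _ (hX.sub hs) hs, sub_add_cancel]
    have h3 : hsSq (A * (1 - ∑ i ∈ s, ketbra (onb H i))) < ⊤ := hsSq_mul_right_lt_top hA' _
    rw [h2]
    refine (hbound _ (hX.sub hs)).trans ?_
    gcongr
    rw [hsub, ← hsSq_mul_one_sub_sum]
    refine (ENNReal.toReal_mono ENNReal.ofReal_ne_top (traceNorm_mul_le h3 hB')).trans_eq ?_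
    rw [ENNReal.toReal_ofReal (by positivity)]
  have hlim2 := hlim.add (hsum : Tendsto _ _ _)
  simp only [hfY, sub_add_cancel, zero_add] at hlim2
  exact tendsto_nhds_unique tendsto_const_nhds hlim2

theorem norm_le_one_of_le_one {M : H →L[ℂ] H} (h0 : 0 ≤ M) (h1 : M ≤ 1) : ‖M‖ ≤ 1 :=
  (CStarAlgebra.norm_le_one_iff_of_nonneg M h0).2 h1

/-- Weak operator compactness of the set of tests `0 ≤ M ≤ 1`, in terms of ultrafilters: the limits
of the matrix elements exist in `ℂ` and form a bounded sesquilinear form. -/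
theorem exists_weak_limit {ι : Type*} (l : Ultrafilter ι) (M : ι → H →L[ℂ] H)
    (h0 : ∀ i, 0 ≤ M i) (h1 : ∀ i, M i ≤ 1) : ∃ N : H →L[ℂ] H, 0 ≤ N ∧ N ≤ 1 ∧
      ∀ x y, Tendsto (fun i => ⟪x, M i y⟫_ℂ) l (𝓝 ⟪x, N y⟫_ℂ) := by
  have hb : ∀ i x y, ‖⟪x, M i y⟫_ℂ‖ ≤ 1 * ‖x‖ * ‖y‖ := fun i x y => by
    refine (norm_inner_le_norm _ _).trans ?_
    rw [one_mul]
    gcongr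
    simpa using (M i).le_of_opNorm_le (norm_le_one_of_le_one (h0 i) (h1 i)) y
  have hex : ∀ x y, ∃ z, Tendsto (fun i => ⟪x, M i y⟫_ℂ) l (𝓝 z) := by
    intro x y
    obtain ⟨z, -, hz⟩ := (isCompact_closedBall (0 : ℂ) (1 * ‖x‖ * ‖y‖)).ultrafilter_le_nhds
      (l.map fun i => ⟪x, M i y⟫_ℂ) (by
        rw [le_principal_iff, Ultrafilter.mem_coe, Ultrafilter.mem_map]
        exact univ_mem' fun i => by simpa using! hb i x y)
    exact ⟨z, hz⟩
  choose B hB using hex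
  obtain ⟨N, hN⟩ := exists_inner_eq_of_form B 1
    (fun x x' y => tendsto_nhds_unique (hB _ _)
      (by simpa only [inner_add_left] using (hB x y).add (hB x' y)))
    (fun c x y => tendsto_nhds_unique (hB _ _)
      (by simpa only [inner_smul_left] using (hB x y).const_mul _))
    (fun x y y' => tendsto_nhds_unique (hB _ _)
      (by simpa only [map_add, inner_add_right] using (hB x y).add (hB x y')))
    (fun c x y => tendsto_nhds_unique (hB _ _)
      (by simpa only [map_smul, inner_smul_right] using (hB x y).const_mul _))
    (fun x y => le_of_tendsto (hB x y).norm (.of_forall fun i => hb i x y))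
  refine ⟨N, ?_, ?_, fun x y => hN x y ▸ hB x y⟩
  · rw [nonneg_iff_inner_nonneg]
    intro x
    rw [hN]
    exact ge_of_tendsto' (hB x x) fun i => nonneg_iff_inner_nonneg.1 (h0 i) x
  · rw [← sub_nonneg, nonneg_iff_inner_nonneg]
    intro x
    rw [_root_.sub_apply, inner_sub_right, hN]
    refine ge_of_tendsto' ((hB x x).const_sub _) fun i => ?_
    have := nonneg_iff_inner_nonneg.1 (sub_nonneg.2 (h1 i)) x
    rwa [_root_.sub_apply, inner_sub_right] at this

/-- A finite dimensional minimax statement: if for every mixture of the functionals `φ i` some point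
of `K` has a value above `c`, then some point of `K` does so for all `φ i` simultaneously. Otherwise
the constant vector `c` could be separated from the open convex set of all vectors lying strictly
below some `(φ i M)_i` with `M ∈ K`. -/
theorem exists_forall_lt_of_forall_stdSimplex {V I : Type*} [AddCommGroup V] [Module ℝ V]
    [Fintype I] {K : Set V} (hK : Convex ℝ K) (hne : K.Nonempty) (φ : I → V →ₗ[ℝ] ℝ) (c : ℝ)
    (h : ∀ w ∈ stdSimplex ℝ I, ∃ M ∈ K, c < ∑ i, w i * φ i M) :
    ∃ M ∈ K, ∀ i, c < φ i M := by
  classical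
  let O : Set (I → ℝ) := {y | ∃ M ∈ K, ∀ i, y i < φ i M}
  have hO : IsOpen O := by
    have : O = ⋃ M ∈ K, Set.univ.pi fun i => Set.Iio (φ i M) := by
      ext y; simp [O]
    rw [this]
    exact isOpen_biUnion fun M _ => isOpen_set_pi Set.finite_univ fun i _ => isOpen_Iio
  have hconv : Convex ℝ O := by
    rintro y ⟨M, hM, hy⟩ y' ⟨M', hM', hy'⟩ a b ha hb hab
    refine ⟨a • M + b • M', hK hM hM' ha hb hab, fun i => ?_⟩
    simp only [Pi.add_apply, Pi.smul_apply, smul_eq_mul, map_add, map_smul]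
    rcases ha.eq_or_lt with rfl | ha'
    · have : b = 1 := by linarith
      subst this
      simpa using hy' i
    · have := mul_lt_mul_of_pos_left (hy i) ha'
      have := mul_le_mul_of_nonneg_left (hy' i).le hb
      linarith
  by_contra hcon
  have hc : (fun _ => c) ∉ O := fun ⟨M, hM, hi⟩ => hcon ⟨M, hM, hi⟩
  obtain ⟨f, hf⟩ := geometric_hahn_banach_open_point hconv hO hc
  have hfs : ∀ y, f y = ∑ i, y i * f (Pi.single i 1) := by
    intro y
    conv_lhs => rw [pi_eq_sum_univ' y]
    simp [map_sum]
  -- the separating functional is nonnegative as `O` is stable under decreasing a coordinate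
  obtain ⟨M₀, hM₀⟩ := hne
  have hy₀ : ∀ j, ∀ t : ℝ, 0 ≤ t →
      (fun i => φ i M₀ - 1) - t • (Pi.single j 1 : I → ℝ) ∈ O := by
    intro j t ht
    refine ⟨M₀, hM₀, fun i => ?_⟩
    have : 0 ≤ t * (Pi.single j 1 : I → ℝ) i := by
      rw [Pi.single_apply]; split_ifs <;> simp [ht]
    simp only [Pi.sub_apply, Pi.smul_apply, smul_eq_mul]
    linarith
  have hpos : ∀ j, 0 ≤ f (Pi.single j 1) := by
    intro j
    by_contra! hneg
    set D := f (fun _ => c) - f (fun i => φ i M₀ - 1) with hD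
    have hD0 : 0 < D := by
      have := hf _ (hy₀ j 0 le_rfl)
      simp only [zero_smul, sub_zero] at this
      linarith
    have := hf _ (hy₀ j (D / -f (Pi.single j 1)) (div_nonneg hD0.le (by linarith)))
    rw [map_sub, map_smul, smul_eq_mul] at this
    have h2 : D / -f (Pi.single j 1) * f (Pi.single j 1) = -D := by
      rw [div_neg, neg_mul, div_mul_cancel₀ _ hneg.ne]
    linarith
  -- normalizing the coefficients of `f` gives the weights that contradict `h`
  set S := ∑ i, f (Pi.single i 1) with hS
  have hS0 : 0 < S := by
    refine lt_of_le_of_ne (Finset.sum_nonneg fun i _ => hpos i) fun h0 => ?_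
    have hz : ∀ i, f (Pi.single i 1) = 0 := fun i =>
      (Finset.sum_eq_zero_iff_of_nonneg fun i _ => hpos i).1 (hS ▸ h0.symm) i (Finset.mem_univ i)
    have hfz : ∀ y, f y = 0 := fun y => by rw [hfs]; simp [hz]
    have := hf (fun i => φ i M₀ - 1) ⟨M₀, hM₀, fun i => by simp⟩
    rw [hfz, hfz] at this
    exact lt_irrefl _ this
  obtain ⟨M, hM, hlt⟩ := h (fun i => f (Pi.single i 1) / S)
    ⟨fun i => div_nonneg (hpos i) hS0.le, by rw [← Finset.sum_div, ← hS, div_self hS0.ne']⟩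
  have h1 : ∀ t : ℝ, 0 < t → ∑ i, (φ i M - t) * f (Pi.single i 1) < c * S := by
    intro t ht
    have := hf (fun i => φ i M - t) ⟨M, hM, fun i => by simp [ht]⟩
    rw [hfs, hfs (fun _ => c), ← Finset.mul_sum] at this
    exact this
  have h2 : ∑ i, φ i M * f (Pi.single i 1) ≤ c * S := by
    refine le_of_forall_pos_lt_add fun t ht => ?_
    have := h1 (t / S) (by positivity)
    simp_rw [sub_mul] at this
    rw [Finset.sum_sub_distrib, ← Finset.mul_sum, ← hS, div_mul_cancel₀ _ hS0.ne'] at this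
    linarith
  have h3 : ∑ i, f (Pi.single i 1) / S * φ i M = (∑ i, φ i M * f (Pi.single i 1)) / S := by
    rw [Finset.sum_div]
    exact Finset.sum_congr rfl fun i _ => by ring
  rw [h3, lt_div_iff₀ hS0] at hlt
  linarith

end Forms

/-! ### A test good for many vectors at once -/

section UniversalTest

variable {H : Type*} [NormedAddCommGroup H] [InnerProductSpace ℂ H]

theorem real_smul_eq (a : ℝ) (M : H →L[ℂ] H) : a • M = (a : ℂ) • M := by
  ext v
  simp

variable [CompleteSpace H]

/-- The trace `tr (M ρ)` as a series of values of the quadratic form of `M`. Its terms are nonnegative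
for `M ≥ 0` and weakly continuous in `M`. -/
theorem hasSum_inner_sqrt_of_nonneg {ρ : H →L[ℂ] H} (h0 : 0 ≤ ρ) (hρ : IsTraceClass ρ)
    (M : H →L[ℂ] H) :
    HasSum (fun i => ⟪CFC.sqrt ρ (onb H i), M (CFC.sqrt ρ (onb H i))⟫_ℂ) (trace (M * ρ)) := by
  have hS : hsSq (CFC.sqrt ρ) < ⊤ := by
    rwa [hsSq_sqrt h0, ← isTraceClass_iff_of_nonneg h0]
  have h := hasSum_inner_mul_of_hsSq' (onb H) hS (hsSq_mul_left_lt_top hS M)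
  rw [mul_assoc, CFC.sqrt_mul_sqrt_self ρ h0] at h
  convert! h using 2 with i
  rw [mul_apply_eq_comp, mul_apply_eq_comp,
    ← ContinuousLinearMap.adjoint_inner_left (CFC.sqrt ρ),
    ← ContinuousLinearMap.star_eq_adjoint, star_sqrt]

theorem re_trace_mul_nonneg {M ρ : H →L[ℂ] H} (hM : 0 ≤ M) (h0 : 0 ≤ ρ) (hρ : IsTraceClass ρ) :
    0 ≤ (trace (M * ρ)).re :=
  ((hasSum_inner_sqrt_of_nonneg h0 hρ M).mapL Complex.reCLM).nonneg fun _ => re_inner_nonneg hM _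

theorem trace_mul_nonneg {M ρ : H →L[ℂ] H} (hM : 0 ≤ M) (h0 : 0 ≤ ρ) (hρ : IsTraceClass ρ) :
    0 ≤ trace (M * ρ) :=
  (hasSum_inner_sqrt_of_nonneg h0 hρ M).nonneg fun _ => nonneg_iff_inner_nonneg.1 hM _

/-- If for every mixture of finitely many vectors of `V` there is a test `M` with `tr (M ρ)` at most
about `b` and average value at least `c`, then one test with `tr (M ρ) ≤ b` has value at least `c` on
all of `V`. The minimax statement gives, for each finite subset of `V` and each tolerance `1 / (n + 1)`,
a test good for that subset, and a weak limit of these along larger subsets and smaller tolerances is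
as required. -/
theorem exists_universal_test {ρ : H →L[ℂ] H} (h0 : 0 ≤ ρ) (hρ : IsTraceClass ρ) (V : Set H)
    (b c : ℝ) (hb : 0 ≤ b)
    (h : ∀ (F : Finset V), ∀ w ∈ stdSimplex ℝ F, ∀ η > 0, ∃ M : H →L[ℂ] H, 0 ≤ M ∧ M ≤ 1 ∧
      (trace (M * ρ)).re ≤ b + η ∧ c ≤ ∑ v : F, w v * (⟪(v : H), M v⟫_ℂ).re) :
    ∃ M : H →L[ℂ] H, 0 ≤ M ∧ M ≤ 1 ∧ (trace (M * ρ)).re ≤ b ∧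
      ∀ v ∈ V, c ≤ (⟪v, M v⟫_ℂ).re := by
  have step : ∀ p : ℕ × Finset V, ∃ M : H →L[ℂ] H, 0 ≤ M ∧ M ≤ 1 ∧
      (trace (M * ρ)).re ≤ b + 1 / ((p.1 : ℝ) + 1) ∧
      ∀ v ∈ p.2, c - 1 / ((p.1 : ℝ) + 1) < (⟪(v : H), M v⟫_ℂ).re := by
    rintro ⟨n, F⟩
    have hη : 0 < 1 / ((n : ℝ) + 1) := by positivity
    let K : Set (H →L[ℂ] H) := {M | 0 ≤ M ∧ M ≤ 1 ∧ (trace (M * ρ)).re ≤ b + 1 / ((n : ℝ) + 1)}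
    have hK : Convex ℝ K := by
      rintro M ⟨h1, h2, h3⟩ M' ⟨h1', h2', h3'⟩ s t hs ht hst
      have hs' : (0 : ℂ) ≤ s := by exact_mod_cast hs
      have ht' : (0 : ℂ) ≤ t := by exact_mod_cast ht
      refine ⟨?_, ?_, ?_⟩
      · rw [nonneg_iff_inner_nonneg] at h1 h1' ⊢
        intro x
        simp only [real_smul_eq, _root_.add_apply, _root_.smul_apply, inner_add_right,
          inner_smul_right]
        exact add_nonneg (mul_nonneg hs' (h1 x)) (mul_nonneg ht' (h1' x))
      · rw [← sub_nonneg, nonneg_iff_inner_nonneg] at h2 h2' ⊢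
        intro x
        have e : (1 - (s • M + t • M') : H →L[ℂ] H) = s • (1 - M) + t • (1 - M') := by
          rw [smul_sub, smul_sub, sub_add_sub_comm, ← add_smul, hst, one_smul]
        rw [e]
        simp only [real_smul_eq, _root_.add_apply, _root_.smul_apply, inner_add_right,
          inner_smul_right]
        exact add_nonneg (mul_nonneg hs' (h2 x)) (mul_nonneg ht' (h2' x))
      · rw [real_smul_eq, real_smul_eq, add_mul, smul_mul_assoc, smul_mul_assoc,
          ((hρ.mul_left M).smul _).trace_add ((hρ.mul_left M').smul _), trace_smul, trace_smul,
          Complex.add_re, Complex.re_ofReal_mul, Complex.re_ofReal_mul]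
        calc _ ≤ s * (b + 1 / ((n : ℝ) + 1)) + t * (b + 1 / ((n : ℝ) + 1)) := by gcongr
          _ = _ := by rw [← add_mul, hst, one_mul]
    let φ : F → (H →L[ℂ] H) →ₗ[ℝ] ℝ := fun v =>
      { toFun := fun M => (⟪(v : H), M v⟫_ℂ).re
        map_add' := fun M M' => by simp
        map_smul' := fun a M => by simp }
    obtain ⟨M, ⟨h1, h2, h3⟩, h4⟩ := exists_forall_lt_of_forall_stdSimplex hK
      ⟨0, le_rfl, zero_le_one, by simpa [trace] using by positivity⟩ φ
      (c - 1 / ((n : ℝ) + 1)) fun w hw => by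
        obtain ⟨M, h1, h2, h3, h4⟩ := h F w hw _ hη
        exact ⟨M, ⟨h1, h2, h3⟩, (sub_lt_self c hη).trans_le h4⟩
    exact ⟨M, h1, h2, h3, fun v hv => h4 ⟨v, hv⟩⟩
  choose M hM0 hM1 hMtr hMv using step
  classical
  let l : Ultrafilter (ℕ × Finset V) := Ultrafilter.of atTop
  have hl : (l : Filter (ℕ × Finset V)) ≤ atTop := Ultrafilter.of_le _
  obtain ⟨N, hN0, hN1, hN⟩ := exists_weak_limit l M hM0 hM1
  have hfst : Tendsto (fun p : ℕ × Finset V => 1 / ((p.1 : ℝ) + 1)) l (𝓝 0) :=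
    (tendsto_one_div_add_atTop_nhds_zero_nat.comp
      (tendsto_fst.mono_left prod_atTop_atTop_eq.ge)).mono_left hl
  refine ⟨N, hN0, hN1, ?_, fun v hv => ?_⟩
  · -- `M ↦ tr (M ρ)` is weakly lower semicontinuous, as a supremum of weakly continuous partial sums
    have hs : HasSum (fun i => (⟪CFC.sqrt ρ (onb H i), N (CFC.sqrt ρ (onb H i))⟫_ℂ).re)
        (trace (N * ρ)).re := (hasSum_inner_sqrt_of_nonneg h0 hρ N).mapL Complex.reCLM
    refine hasSum_le_of_sum_le hs fun s => ?_
    have h1 : Tendsto (fun p => ∑ i ∈ s,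
        (⟪CFC.sqrt ρ (onb H i), M p (CFC.sqrt ρ (onb H i))⟫_ℂ).re) l
        (𝓝 (∑ i ∈ s, (⟪CFC.sqrt ρ (onb H i), N (CFC.sqrt ρ (onb H i))⟫_ℂ).re)) :=
      tendsto_finsetSum _ fun i _ => (Complex.continuous_re.tendsto _).comp (hN _ _)
    have h2 := hfst.const_add b
    rw [add_zero] at h2
    refine le_of_tendsto_of_tendsto' h1 h2 fun p => ?_
    have hs' : HasSum (fun i => (⟪CFC.sqrt ρ (onb H i), M p (CFC.sqrt ρ (onb H i))⟫_ℂ).re)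
        (trace (M p * ρ)).re := (hasSum_inner_sqrt_of_nonneg h0 hρ (M p)).mapL Complex.reCLM
    exact (sum_le_hasSum s (fun i _ => re_inner_nonneg (hM0 p) _) hs').trans (hMtr p)
  · have h1 := (Complex.continuous_re.tendsto _).comp (hN v v)
    have h2 := hfst.const_sub c
    rw [sub_zero] at h2
    refine le_of_tendsto_of_tendsto h2 h1 ?_
    have hev : ∀ᶠ p : ℕ × Finset V in l, (⟨v, hv⟩ : V) ∈ p.2 :=
      hl ((eventually_ge_atTop ((0, {⟨v, hv⟩}) : ℕ × Finset V)).mono fun p hp =>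
        hp.2 (Finset.mem_singleton_self _))
    filter_upwards [hev] with p hp
    exact (hMv p _ hp).le

end UniversalTest

/-! ### Product bases and tensor products of operators -/

section Tensor

variable {E : Type u} {F : Type v}
  [NormedAddCommGroup E] [InnerProductSpace ℂ E] [NormedAddCommGroup F] [InnerProductSpace ℂ F]

variable (E F) in
/-- The product vector `x ⊗ y` as a continuous bilinear function of `x` and `y`. -/
def tmulL : E →L[ℂ] F →L[ℂ] HTensor E F :=
  (ContinuousLinearMap.compL ℂ F (E ⊗[ℂ] F) (HTensor E F) UniformSpace.Completion.toComplL) ∘L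
    TensorProduct.mkL ℂ E F

theorem tmulL_apply (x : E) (y : F) : tmulL E F x y = tmul x y := rfl

theorem inner_tmul (x x' : E) (y y' : F) :
    ⟪tmul x y, tmul x' y'⟫_ℂ = ⟪x, x'⟫_ℂ * ⟪y, y'⟫_ℂ := by
  rw [tmul, tmul, UniformSpace.Completion.inner_coe, TensorProduct.inner_tmul]

theorem norm_tmul (x : E) (y : F) : ‖(tmul x y : HTensor E F)‖ = ‖x‖ * ‖y‖ := by
  rw [tmul, UniformSpace.Completion.norm_coe, TensorProduct.norm_tmul]

/-- A closed subspace containing all product vectors is everything. -/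
theorem mem_of_forall_tmul_mem {S : Submodule ℂ (HTensor E F)} (hS : IsClosed (S : Set (HTensor E F)))
    (h : ∀ x y, tmul x y ∈ S) (z : HTensor E F) : z ∈ S := by
  refine UniformSpace.Completion.induction_on z hS fun t => ?_
  induction t using TensorProduct.induction_on with
  | zero => rw [UniformSpace.Completion.coe_zero]; exact S.zero_mem
  | tmul x y => exact h x y
  | add a b ha hb => rw [UniformSpace.Completion.coe_add]; exact S.add_mem ha hb

theorem clm_ext_tmul {G : Type*} [NormedAddCommGroup G] [NormedSpace ℂ G]
    {P Q : HTensor E F →L[ℂ] G} (h : ∀ x y, P (tmul x y) = Q (tmul x y)) : P = Q := by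
  ext z
  have := mem_of_forall_tmul_mem (S := LinearMap.ker (P - Q).toLinearMap)
    (ContinuousLinearMap.isClosed_ker (P - Q)) (fun x y => by simp [h]) z
  simpa [sub_eq_zero] using this

theorem ext_inner_tmul {z z' : HTensor E F} (h : ∀ x y, ⟪tmul x y, z⟫_ℂ = ⟪tmul x y, z'⟫_ℂ) :
    z = z' := by
  have : innerSL ℂ z = innerSL ℂ z' := clm_ext_tmul fun x y => by
    rw [innerSL_apply_apply, innerSL_apply_apply, ← inner_conj_symm, h, inner_conj_symm]
  exact ext_inner_right ℂ fun w => congrArg (· w) this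

theorem orthonormal_tmul {ι κ : Type*} {e : ι → E} {f : κ → F} (he : Orthonormal ℂ e)
    (hf : Orthonormal ℂ f) : Orthonormal ℂ fun p : ι × κ => (tmul (e p.1) (f p.2) : HTensor E F) := by
  classical
  rw [orthonormal_iff_ite] at *
  rintro ⟨i, j⟩ ⟨i', j'⟩
  rw [inner_tmul, he, hf]
  simp only [Prod.mk.injEq, ite_and]
  split_ifs <;> simp

/-- The products of the vectors of two orthonormal bases form an orthonormal basis. -/
theorem exists_hilbertBasis_tmul {ι κ : Type*} (e : HilbertBasis ι ℂ E) (f : HilbertBasis κ ℂ F) :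
    ∃ b : HilbertBasis (ι × κ) ℂ (HTensor E F), ∀ p, b p = tmul (e p.1) (f p.2) := by
  set S := (Submodule.span ℂ (Set.range fun p : ι × κ =>
    (tmul (e p.1) (f p.2) : HTensor E F))).topologicalClosure with hSdef
  have hS : IsClosed (S : Set (HTensor E F)) := Submodule.isClosed_topologicalClosure _
  have h1 : ∀ i j, tmul (e i) (f j) ∈ S := fun i j =>
    Submodule.le_topologicalClosure _ (Submodule.subset_span ⟨(i, j), rfl⟩)
  have h2 : ∀ x j, tmul x (f j) ∈ S := fun x j => by
    refine hS.mem_of_tendsto ((e.hasSum_repr x).mapL ((tmulL E F).flip (f j)) : Tendsto _ _ _)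
      (.of_forall fun s => S.sum_mem fun i _ => ?_)
    rw [map_smul]
    exact S.smul_mem _ (h1 i j)
  have h3 : ∀ x y, tmul x y ∈ S := fun x y => by
    refine hS.mem_of_tendsto ((f.hasSum_repr y).mapL (tmulL E F x) : Tendsto _ _ _)
      (.of_forall fun s => S.sum_mem fun i _ => ?_)
    rw [map_smul]
    exact S.smul_mem _ (h2 x i)
  exact ⟨HilbertBasis.mk (orthonormal_tmul e.orthonormal f.orthonormal)
    fun z _ => mem_of_forall_tmul_mem hS h3 z, fun p => by rw [HilbertBasis.coe_mk]⟩

theorem opTensor_mul (S S' : E →L[ℂ] E) (T T' : F →L[ℂ] F) :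
    opTensor (S * S') (T * T') = opTensor S T * opTensor S' T' :=
  clm_ext_tmul fun x y => by simp [opTensor_tmul]

theorem opTensor_ketbra (x : E) (y : F) :
    opTensor (ketbra x) (ketbra y) = ketbra (tmul x y) :=
  clm_ext_tmul fun x' y' => by
    simp only [opTensor_tmul, ketbra, InnerProductSpace.rankOne_apply, inner_tmul]
    rw [← tmulL_apply, map_smul, map_smul, _root_.smul_apply, smul_smul, tmulL_apply, mul_comm]

variable [CompleteSpace E] [CompleteSpace F]

theorem star_opTensor (S : E →L[ℂ] E) (T : F →L[ℂ] F) :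
    star (opTensor S T) = opTensor (star S) (star T) :=
  clm_ext_tmul fun x y => ext_inner_tmul fun x' y' => by
    simp only [ContinuousLinearMap.star_eq_adjoint, ContinuousLinearMap.adjoint_inner_right,
      opTensor_tmul, inner_tmul]

theorem opTensor_eq_star_mul_self {S : E →L[ℂ] E} {T : F →L[ℂ] F} (hS : 0 ≤ S) (hT : 0 ≤ T) :
    opTensor S T = star (opTensor (CFC.sqrt S) (CFC.sqrt T)) *
      opTensor (CFC.sqrt S) (CFC.sqrt T) := by
  rw [star_opTensor, ← opTensor_mul, star_sqrt_mul_sqrt hS, star_sqrt_mul_sqrt hT]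

theorem opTensor_nonneg {S : E →L[ℂ] E} {T : F →L[ℂ] F} (hS : 0 ≤ S) (hT : 0 ≤ T) :
    0 ≤ opTensor S T := by
  rw [opTensor_eq_star_mul_self hS hT]
  exact star_mul_self_nonneg (opTensor (CFC.sqrt S) (CFC.sqrt T))

theorem posTrace_opTensor {S : E →L[ℂ] E} {T : F →L[ℂ] F} (hS : 0 ≤ S) (hT : 0 ≤ T) :
    posTrace (opTensor S T) = posTrace S * posTrace T := by
  obtain ⟨b, hb⟩ := exists_hilbertBasis_tmul (onb E) (onb F)
  rw [opTensor_eq_star_mul_self hS hT, posTrace_star_mul_self, hsSq_eq_tsum b,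
    ENNReal.tsum_prod', ← hsSq_sqrt hS, ← hsSq_sqrt hT, hsSq, hsSq, ← ENNReal.tsum_mul_right]
  refine tsum_congr fun i => ?_
  rw [← ENNReal.tsum_mul_left]
  refine tsum_congr fun j => ?_
  rw [hb, opTensor_tmul, ← ofReal_norm, norm_tmul, ENNReal.ofReal_mul (norm_nonneg _), mul_pow,
    ofReal_norm, ofReal_norm]

end Tensor

/-! ### Unitary conjugation -/

section Conj

variable {H K : Type*} [NormedAddCommGroup H] [InnerProductSpace ℂ H]
  [NormedAddCommGroup K] [InnerProductSpace ℂ K]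

theorem conj_ketbra (U : H ≃ₗᵢ[ℂ] K) (x : H) :
    (U : H →L[ℂ] K) ∘L ketbra x ∘L (U.symm : K →L[ℂ] H) = ketbra (U x) := by
  ext v
  have : ⟪U x, v⟫_ℂ = ⟪x, U.symm v⟫_ℂ := by
    rw [← U.inner_map_map x, U.apply_symm_apply]
  simp [ketbra, this]

theorem hilbertBasis_sum_ketbra {ι : Type*} [Fintype ι] (b : HilbertBasis ι ℂ H) :
    ∑ i, ketbra (b i) = (1 : H →L[ℂ] H) := by
  have := b.toOrthonormalBasis.sum_rankOne_eq_id
  simpa [ketbra] using! this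

variable [CompleteSpace H] [CompleteSpace K]

theorem isState_conj (U : H ≃ₗᵢ[ℂ] K) {P : H →L[ℂ] H} (hP : IsState P) :
    IsState ((U : H →L[ℂ] K) ∘L P ∘L (U.symm : K →L[ℂ] H)) := by
  rw [isState_iff] at hP ⊢
  have hinner : ∀ x, ⟪x, ((U : H →L[ℂ] K) ∘L P ∘L (U.symm : K →L[ℂ] H)) x⟫_ℂ =
      ⟪U.symm x, P (U.symm x)⟫_ℂ := fun x => by
    rw [← U.inner_map_map]
    simp
  have h0 : 0 ≤ (U : H →L[ℂ] K) ∘L P ∘L (U.symm : K →L[ℂ] H) := by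
    rw [nonneg_iff_inner_nonneg]
    intro x
    rw [hinner]
    exact nonneg_iff_inner_nonneg.1 hP.1 _
  refine ⟨h0, ?_⟩
  rw [posTrace_eq_tsum (HilbertBasis.ofRepr (U.symm.trans (onb H).repr)) h0, ← hP.2,
    posTrace_eq_tsum (onb H) hP.1]
  refine tsum_congr fun i => ?_
  rw [hinner]
  have : U.symm ((HilbertBasis.ofRepr (U.symm.trans (onb H).repr)) i) = onb H i := by
    classical
    rw [← HilbertBasis.repr_symm_single, ← HilbertBasis.repr_symm_single]
    simp
  rw [this]

end Conj

/-! ### Tensor powers of states and of the maximally entangled vector -/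

section Power

/-- The product basis of `A^{⊗ (m + 1)}`, stated for a space known only propositionally to be
`X ⊗ A`, as in the definition of `snoc`. -/
theorem exists_hilbertBasis_snocAux {A : Type u} [NormedAddCommGroup A] [InnerProductSpace ℂ A]
    {ι κ : Type*} (X X' : HilbertSp.{u})
    (hX : X' = ⟨HTensor X.carrier A⟩) (b : HilbertBasis ι ℂ X.carrier) (e : HilbertBasis κ ℂ A) :
    ∃ b' : HilbertBasis (ι × κ) ℂ X'.carrier, ∀ p, b' p = snocAux X X' hX (b p.1) (e p.2) := by
  subst hX
  exact exists_hilbertBasis_tmul b e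

variable {A : Type u} [NormedAddCommGroup A] [InnerProductSpace ℂ A] [CompleteSpace A]
variable {B : Type v} [NormedAddCommGroup B] [InnerProductSpace ℂ B] [CompleteSpace B]

variable (A) in
/-- The basis of the one-dimensional space `A^{⊗ 0}`. -/
def powZeroBasis : HilbertBasis PUnit.{u + 1} ℂ (TPow A 0) :=
  (EuclideanSpace.basisFun PUnit.{u + 1} ℂ).toHilbertBasis

theorem isState_opPow {ρ : HTensor A B →L[ℂ] HTensor A B} (hρ : IsState ρ) (n : ℕ) :
    IsState (opPow ρ n) := by
  induction n with
  | zero =>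
    obtain ⟨b, hb⟩ := exists_hilbertBasis_tmul (powZeroBasis A) (powZeroBasis B)
    refine isState_iff.2 ⟨zero_le_one, ?_⟩
    change posTrace (1 : Copies A B 0 →L[ℂ] Copies A B 0) = 1
    rw [posTrace_eq_tsum b zero_le_one, tsum_fintype]
    have : ∀ i, ⟪b i, (1 : Copies A B 0 →L[ℂ] Copies A B 0) (b i)⟫_ℂ = 1 := fun i => by
      rw [one_apply_eq_self, inner_self_eq_norm_sq_to_K, b.orthonormal.norm_eq_one]
      simp
    simp_rw [this]
    simp
  | succ n ih =>
    refine isState_conj (regroup A B n) (P := opTensor (opPow ρ n) ρ) ?_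
    rw [isState_iff] at hρ ih ⊢
    exact ⟨opTensor_nonneg ih.1 hρ.1, by rw [posTrace_opTensor ih.1 hρ.1, ih.2, hρ.2, one_mul]⟩

/-- The `m`-fold tensor power of the maximally entangled vector. -/
def bellPow : (m : ℕ) → Copies Qubit Qubit m
  | 0 => tmul (powZeroBasis Qubit PUnit.unit) (powZeroBasis Qubit PUnit.unit)
  | m + 1 => regroup Qubit Qubit m (tmul (bellPow m) bellVector)

theorem opPow_bell (m : ℕ) : opPow bell m = ketbra (bellPow m) := by
  induction m with
  | zero =>
    obtain ⟨b, hb⟩ := exists_hilbertBasis_tmul (powZeroBasis Qubit) (powZeroBasis Qubit)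
    have := hilbertBasis_sum_ketbra b
    rw [Fintype.sum_prod_type, Fintype.sum_unique, Fintype.sum_unique, hb] at this
    exact this.symm
  | succ m ih =>
    rw [opPow, ih, bell, opTensor_ketbra, conj_ketbra]
    rfl

/-- The Schmidt decomposition of the `m`-fold maximally entangled vector: in a product basis it is
the maximally entangled vector of rank `2 ^ m`. -/
theorem exists_bellPow_eq (m : ℕ) : ∃ (ι : Type) (_ : Fintype ι)
    (b : HilbertBasis ι ℂ (TPow Qubit m)), Fintype.card ι = 2 ^ m ∧
    bellPow m = ((√(2 ^ m))⁻¹ : ℂ) • ∑ i, tmul (b i) (b i) := by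
  induction m with
  | zero => exact ⟨PUnit, inferInstance, powZeroBasis Qubit, by simp, by simp [bellPow]⟩
  | succ m ih =>
    obtain ⟨ι, _, b, hcard, hb⟩ := ih
    let e : HilbertBasis (Fin 2) ℂ Qubit := (EuclideanSpace.basisFun (Fin 2) ℂ).toHilbertBasis
    obtain ⟨b', hb'⟩ := exists_hilbertBasis_snocAux _ (powSp Qubit (m + 1)) rfl b e
    refine ⟨ι × Fin 2, inferInstance, b', by simp [hcard, pow_succ], ?_⟩
    have he : ∀ j, e j = EuclideanSpace.single j 1 := fun j => by simp [e]
    have hv : bellVector = ((1 / √2 : ℝ) : ℂ) • ∑ j, tmul (e j) (e j) := by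
      rw [Fin.sum_univ_two, he, he]
      rfl
    change regroup Qubit Qubit m (tmul (bellPow m) bellVector) = _
    rw [hb, hv, ← tmulL_apply]
    simp only [map_smul, map_sum, _root_.smul_apply, _root_.sum_apply, tmulL_apply, regroup_tmul]
    rw [Fintype.sum_prod_type]
    simp only [hb', Finset.smul_sum]
    rw [Finset.sum_comm]
    refine Finset.sum_congr rfl fun i _ => Finset.sum_congr rfl fun j _ => ?_
    rw [smul_smul]
    refine congrArg₂ (· • ·) ?_ rfl
    rw [pow_succ, Real.sqrt_mul (by positivity)]
    push_cast
    rw [mul_inv, mul_comm, one_div]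

end Power

/-! ### Rank one states and convex hulls of states -/

section States

variable {H : Type*} [NormedAddCommGroup H] [InnerProductSpace ℂ H]

theorem ketbra_apply (x y : H) : ketbra x y = ⟪x, y⟫_ℂ • x := rfl

theorem ketbra_smul (a : ℂ) (x : H) : ketbra (a • x) = ((‖a‖ ^ 2 : ℝ) : ℂ) • ketbra x := by
  ext y
  rw [ketbra_apply, _root_.smul_apply, ketbra_apply, inner_smul_left, smul_smul, smul_smul,
    mul_right_comm, RCLike.conj_mul]
  simp

theorem ketbra_nonneg (x : H) : 0 ≤ ketbra x := by
  rw [ContinuousLinearMap.nonneg_iff_isPositive]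
  exact InnerProductSpace.isPositive_rankOne_self x

theorem smul_nonneg_of_real {a : ℝ} (ha : 0 ≤ a) {P : H →L[ℂ] H} (hP : 0 ≤ P) :
    0 ≤ (a : ℂ) • P := by
  rw [nonneg_iff_inner_nonneg] at hP ⊢
  intro x
  rw [_root_.smul_apply, inner_smul_right]
  exact mul_nonneg (by exact_mod_cast ha) (hP x)

variable [CompleteSpace H]

theorem isTraceClass_ketbra (x : H) : IsTraceClass (ketbra x) := isTraceClass_rankOne x x

theorem trace_mul_ketbra (M : H →L[ℂ] H) (x : H) : trace (M * ketbra x) = ⟪x, M x⟫_ℂ :=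
  trace_mul_rankOne M x x

theorem trace_ketbra (x : H) : trace (ketbra x) = ((‖x‖ ^ 2 : ℝ) : ℂ) := by
  rw [ketbra, trace_rankOne, inner_self_eq_norm_sq_to_K]
  simp

theorem isState_ketbra {x : H} (hx : ‖x‖ = 1) : IsState (ketbra x) :=
  ⟨ketbra_nonneg x, isTraceClass_ketbra x, by rw [trace_ketbra, hx]; simp⟩

theorem ketbra_le_one {x : H} (hx : ‖x‖ = 1) : ketbra x ≤ 1 := by
  rw [← CStarAlgebra.norm_le_one_iff_of_nonneg _ (ketbra_nonneg x), ketbra,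
    InnerProductSpace.norm_rankOne, hx, one_mul]

theorem convex_setOf_isState : Convex ℝ {P : H →L[ℂ] H | IsState P} := by
  rintro P ⟨h1, h2, h3⟩ Q ⟨h1', h2', h3'⟩ s t hs ht hst
  rw [real_smul_eq, real_smul_eq]
  refine ⟨add_nonneg (smul_nonneg_of_real hs h1) (smul_nonneg_of_real ht h1'),
    (h2.smul _).add (h2'.smul _), ?_⟩
  rw [(h2.smul _).trace_add (h2'.smul _), trace_smul, trace_smul, h3, h3', mul_one, mul_one]
  exact_mod_cast hst

theorem isState_of_mem_convexHull_of_forall {S : Set (H →L[ℂ] H)} (hS : ∀ P ∈ S, IsState P)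
    {τ : H →L[ℂ] H} (h : τ ∈ convexHull ℝ S) : IsState τ :=
  convexHull_min (t := {P | IsState P}) hS convex_setOf_isState h

theorem le_re_trace_mul_of_mem_convexHull_of_forall {S : Set (H →L[ℂ] H)} {N : H →L[ℂ] H} {c : ℝ}
    (hS : ∀ P ∈ S, IsTraceClass P ∧ c ≤ (trace (N * P)).re)
    {τ : H →L[ℂ] H} (hτ : τ ∈ convexHull ℝ S) : c ≤ (trace (N * τ)).re := by
  have hconv : Convex ℝ {P : H →L[ℂ] H | IsTraceClass P ∧ c ≤ (trace (N * P)).re} := by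
    rintro P ⟨h1, h2⟩ Q ⟨h1', h2'⟩ s t hs ht hst
    rw [real_smul_eq, real_smul_eq]
    refine ⟨(h1.smul _).add (h1'.smul _), ?_⟩
    rw [mul_add, mul_smul_comm, mul_smul_comm,
      ((h1.mul_left N).smul _).trace_add ((h1'.mul_left N).smul _), trace_smul, trace_smul,
      Complex.add_re, Complex.re_ofReal_mul, Complex.re_ofReal_mul]
    calc c = s * c + t * c := by rw [← add_mul, hst, one_mul]
      _ ≤ _ := by gcongr
  exact (convexHull_min (t := {P | IsTraceClass P ∧ c ≤ (trace (N * P)).re}) hS hconv hτ).2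

end States

/-! ### Separable states -/

section Separable

variable {A : Type u} [NormedAddCommGroup A] [InnerProductSpace ℂ A]
variable {B : Type v} [NormedAddCommGroup B] [InnerProductSpace ℂ B]

theorem isState_of_mem_convexHull {τ : HTensor A B →L[ℂ] HTensor A B}
    (h : τ ∈ convexHull ℝ (pureProduct A B)) : IsState τ := by
  refine isState_of_mem_convexHull_of_forall ?_ h
  rintro _ ⟨ψ, φ, hψ, hφ, rfl⟩
  rw [opTensor_ketbra]
  exact isState_ketbra (by rw [norm_tmul, hψ, hφ, one_mul])

theorem exists_mem_convexHull_traceNorm_sub_lt {σ : HTensor A B →L[ℂ] HTensor A B}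
    (hσ : σ ∈ separable A B) {δ : ℝ} (hδ : 0 < δ) :
    ∃ τ ∈ convexHull ℝ (pureProduct A B), IsTraceClass (σ - τ) ∧ (traceNorm (σ - τ)).toReal < δ := by
  obtain ⟨τ, hτ, h⟩ := hσ (Real.toNNReal δ) (by simpa using hδ)
  refine ⟨τ, hτ, h.trans ENNReal.coe_lt_top, ?_⟩
  have := ENNReal.toReal_strict_mono ENNReal.coe_ne_top h
  simpa [hδ.le] using this

theorem convexHull_subset_separable : convexHull ℝ (pureProduct A B) ⊆ separable A B := by
  intro τ hτ δ hδ
  refine ⟨τ, hτ, ?_⟩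
  rw [sub_self, traceNorm]
  simpa [posTrace] using hδ

theorem isState_of_mem_separable {σ : HTensor A B →L[ℂ] HTensor A B}
    (hσ : σ ∈ separable A B) : IsState σ := by
  have htc : IsTraceClass σ := by
    obtain ⟨τ, hτ, h, -⟩ := exists_mem_convexHull_traceNorm_sub_lt hσ one_pos
    simpa using h.add (isState_of_mem_convexHull hτ).2.1
  refine ⟨?_, htc, ?_⟩
  · rw [nonneg_iff_inner_nonneg]
    intro x
    have hcl : IsClosed (Set.Ici (0 : ℂ)) := isClosed_Ici
    refine hcl.closure_subset (Metric.mem_closure_iff.2 fun δ hδ => ?_)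
    obtain ⟨τ, hτ, h, hlt⟩ := exists_mem_convexHull_traceNorm_sub_lt hσ
      (δ := δ / (‖x‖ ^ 2 + 1)) (by positivity)
    refine ⟨⟪x, τ x⟫_ℂ, nonneg_iff_inner_nonneg.1 (isState_of_mem_convexHull hτ).1 x, ?_⟩
    rw [dist_eq_norm, ← inner_sub_right, ← _root_.sub_apply]
    calc ‖⟪x, (σ - τ) x⟫_ℂ‖ ≤ ‖x‖ * (‖σ - τ‖ * ‖x‖) :=
          (norm_inner_le_norm _ _).trans (by gcongr; exact ContinuousLinearMap.le_opNorm _ _)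
      _ = ‖σ - τ‖ * ‖x‖ ^ 2 := by ring
      _ ≤ δ / (‖x‖ ^ 2 + 1) * ‖x‖ ^ 2 := by gcongr; exact h.norm_le.trans hlt.le
      _ < δ / (‖x‖ ^ 2 + 1) * (‖x‖ ^ 2 + 1) := by gcongr; linarith
      _ = δ := by field_simp
  · refine eq_of_forall_dist_le fun δ hδ => ?_
    obtain ⟨τ, hτ, h, hlt⟩ := exists_mem_convexHull_traceNorm_sub_lt hσ hδ
    have hst := isState_of_mem_convexHull hτ
    have h1 := h.norm_trace_mul_left_le 1
    rw [one_mul, htc.trace_sub hst.2.1, hst.2.2] at h1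
    rw [dist_eq_norm]
    refine h1.trans (le_trans ?_ hlt.le)
    exact mul_le_of_le_one_left (by positivity) ContinuousLinearMap.norm_id_le

theorem le_re_trace_mul_of_mem_convexHull {N : HTensor A B →L[ℂ] HTensor A B} {c : ℝ}
    (h : ∀ (ψ : A) (φ : B), ‖ψ‖ = 1 → ‖φ‖ = 1 → c ≤ (⟪tmul ψ φ, N (tmul ψ φ)⟫_ℂ).re)
    {τ : HTensor A B →L[ℂ] HTensor A B} (hτ : τ ∈ convexHull ℝ (pureProduct A B)) :
    c ≤ (trace (N * τ)).re := by
  refine le_re_trace_mul_of_mem_convexHull_of_forall ?_ hτ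
  rintro _ ⟨ψ, φ, hψ, hφ, rfl⟩
  rw [opTensor_ketbra]
  exact ⟨isTraceClass_ketbra _, by rw [trace_mul_ketbra]; exact h ψ φ hψ hφ⟩

/-- A lower bound for `tr (N σ)` over the separable states need only be checked on product
vectors. -/
theorem le_re_trace_mul_of_mem_separable {N : HTensor A B →L[ℂ] HTensor A B} {c : ℝ}
    (h : ∀ (ψ : A) (φ : B), ‖ψ‖ = 1 → ‖φ‖ = 1 → c ≤ (⟪tmul ψ φ, N (tmul ψ φ)⟫_ℂ).re)
    {σ : HTensor A B →L[ℂ] HTensor A B} (hσ : σ ∈ separable A B) :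
    c ≤ (trace (N * σ)).re := by
  refine le_of_forall_pos_le_add fun δ hδ => ?_
  obtain ⟨τ, hτ, htc, hlt⟩ := exists_mem_convexHull_traceNorm_sub_lt hσ
    (δ := δ / (‖N‖ + 1)) (by positivity)
  have h1 := le_re_trace_mul_of_mem_convexHull h hτ
  have h2 := htc.norm_trace_mul_left_le N
  rw [mul_sub, ((isState_of_mem_separable hσ).2.1.mul_left N).trace_sub
    ((isState_of_mem_convexHull hτ).2.1.mul_left N)] at h2
  have h3 : ‖N‖ * (traceNorm (σ - τ)).toReal ≤ δ := by
    calc _ ≤ (‖N‖ + 1) * (δ / (‖N‖ + 1)) := by gcongr; linarith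
      _ = δ := by field_simp
  have h4 := (Complex.abs_re_le_norm _).trans (h2.trans h3)
  rw [Complex.sub_re, abs_le] at h4
  linarith [h4.1]

/-- The cone of unnormalized separable operators: the nonnegative multiples of the convex
combinations of pure product states. It allows sums of positive operators to be handled without
keeping track of normalizations. -/
def separableCone (A : Type u) [NormedAddCommGroup A] [InnerProductSpace ℂ A]
    (B : Type v) [NormedAddCommGroup B] [InnerProductSpace ℂ B] :
    Set (HTensor A B →L[ℂ] HTensor A B) :=
  {P | ∃ w : ℝ, 0 ≤ w ∧ ∃ τ ∈ convexHull ℝ (pureProduct A B), P = (w : ℂ) • τ}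

theorem add_mem_separableCone {P Q : HTensor A B →L[ℂ] HTensor A B}
    (hP : P ∈ separableCone A B) (hQ : Q ∈ separableCone A B) : P + Q ∈ separableCone A B := by
  obtain ⟨w, hw, τ, hτ, rfl⟩ := hP
  obtain ⟨w', hw', τ', hτ', rfl⟩ := hQ
  rcases (add_nonneg hw hw').eq_or_lt with h | h
  · have h1 : w = 0 := by linarith
    have h2 : w' = 0 := by linarith
    exact ⟨0, le_rfl, τ, hτ, by simp [h1, h2]⟩
  · refine ⟨w + w', h.le, (w / (w + w')) • τ + (w' / (w + w')) • τ',
      convex_convexHull ℝ _ hτ hτ' (by positivity) (by positivity)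
        (by rw [← add_div, div_self h.ne']), ?_⟩
    rw [real_smul_eq, real_smul_eq, smul_add, smul_smul, smul_smul, ← Complex.ofReal_mul,
      ← Complex.ofReal_mul, mul_div_cancel₀ _ h.ne', mul_div_cancel₀ _ h.ne']

theorem smul_mem_separableCone {P : HTensor A B →L[ℂ] HTensor A B} {a : ℝ} (ha : 0 ≤ a)
    (hP : P ∈ separableCone A B) : (a : ℂ) • P ∈ separableCone A B := by
  obtain ⟨w, hw, τ, hτ, rfl⟩ := hP
  exact ⟨a * w, by positivity, τ, hτ, by rw [smul_smul, Complex.ofReal_mul]⟩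

theorem zero_mem_separableCone (hne : (pureProduct A B).Nonempty) :
    (0 : HTensor A B →L[ℂ] HTensor A B) ∈ separableCone A B := by
  obtain ⟨τ, hτ⟩ := hne
  exact ⟨0, le_rfl, τ, subset_convexHull ℝ _ hτ, by simp⟩

theorem sum_mem_separableCone (hne : (pureProduct A B).Nonempty) {ι : Type*} (s : Finset ι)
    {P : ι → HTensor A B →L[ℂ] HTensor A B} (h : ∀ i ∈ s, P i ∈ separableCone A B) :
    ∑ i ∈ s, P i ∈ separableCone A B := by
  classical
  induction s using Finset.induction_on with
  | empty => simpa using zero_mem_separableCone hne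
  | insert a s ha ih =>
    rw [Finset.sum_insert ha]
    exact add_mem_separableCone (h a (by simp)) (ih fun i hi => h i (by simp [hi]))

theorem ketbra_tmul_mem_separableCone (hne : (pureProduct A B).Nonempty) (a : A) (b : B) :
    ketbra (tmul a b) ∈ separableCone A B := by
  by_cases ha : a = 0
  · rw [ha, ← tmulL_apply]
    simpa [ketbra] using zero_mem_separableCone hne
  by_cases hb : b = 0
  · rw [hb, ← tmulL_apply]
    simpa [ketbra] using zero_mem_separableCone hne
  have ha' : ‖a‖ ≠ 0 := by simpa using ha
  have hb' : ‖b‖ ≠ 0 := by simpa using hb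
  have hab : tmul a b = ((‖a‖ * ‖b‖ : ℝ) : ℂ) •
      (tmul (((‖a‖⁻¹ : ℝ) : ℂ) • a) (((‖b‖⁻¹ : ℝ) : ℂ) • b) : HTensor A B) := by
    rw [← tmulL_apply, ← tmulL_apply, map_smul, map_smul, _root_.smul_apply, smul_smul, smul_smul,
      ← Complex.ofReal_mul, ← Complex.ofReal_mul]
    have : ‖a‖ * ‖b‖ * ‖b‖⁻¹ * ‖a‖⁻¹ = 1 := by field_simp
    rw [this, Complex.ofReal_one, one_smul]
  have hmem : ketbra (tmul (((‖a‖⁻¹ : ℝ) : ℂ) • a) (((‖b‖⁻¹ : ℝ) : ℂ) • b) : HTensor A B) ∈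
      pureProduct A B := by
    refine ⟨_, _, ?_, ?_, (opTensor_ketbra _ _).symm⟩
    · rw [norm_smul, Complex.norm_real, norm_inv, norm_norm, inv_mul_cancel₀ ha']
    · rw [norm_smul, Complex.norm_real, norm_inv, norm_norm, inv_mul_cancel₀ hb']
  rw [hab, ketbra_smul]
  exact ⟨_, by positivity, _, subset_convexHull ℝ _ hmem, rfl⟩

theorem mem_convexHull_of_mem_separableCone {P : HTensor A B →L[ℂ] HTensor A B}
    (hP : P ∈ separableCone A B) {w : ℝ} (hw : 0 < w) (htr : trace P = w) :
    w⁻¹ • P ∈ convexHull ℝ (pureProduct A B) := by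
  obtain ⟨w', hw', τ, hτ, rfl⟩ := hP
  rw [trace_smul, (isState_of_mem_convexHull hτ).2.2, mul_one] at htr
  have : w' = w := by exact_mod_cast htr
  rw [this, real_smul_eq, smul_smul, ← Complex.ofReal_mul, inv_mul_cancel₀ hw.ne']
  simpa using hτ

/-- Twirling the vectors `u + z̄ p + z q` over the fourth roots of unity `z` removes all cross
terms. -/
theorem sum_ketbra_fourthRoots {H : Type*} [NormedAddCommGroup H] [InnerProductSpace ℂ H]
    (u p q : H) :
    ketbra (u + p + q) + ketbra (u - p - q) + ketbra (u - Complex.I • p + Complex.I • q) +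
      ketbra (u + Complex.I • p - Complex.I • q) =
      (4 : ℂ) • (ketbra u + ketbra p + ketbra q) := by
  ext v
  simp only [ketbra_apply, _root_.add_apply, _root_.smul_apply, inner_add_left, inner_sub_left,
    inner_smul_left, Complex.conj_I]
  have hI : Complex.I ^ 2 = -1 := Complex.I_sq
  match_scalars
  · ring
  · linear_combination (2 * ⟪q, v⟫_ℂ - 2 * ⟪p, v⟫_ℂ) * hI
  · linear_combination (2 * ⟪p, v⟫_ℂ - 2 * ⟪q, v⟫_ℂ) * hI

end Separable

/-! ### Separable mixtures with the maximally entangled state -/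

section Isotropic

variable {X : Type u} [NormedAddCommGroup X] [InnerProductSpace ℂ X]

theorem ketbra_add_eq (x y : X) : ketbra (x + y) = ketbra x + ketbra y +
    InnerProductSpace.rankOne ℂ x y + InnerProductSpace.rankOne ℂ y x := by
  simp only [ketbra, map_add, _root_.add_apply]
  abel

/-- The operator `|aa + bb⟩⟨aa + bb| + |ab⟩⟨ab| + |ba⟩⟨ba|` is a mixture of the four product
vectors `(a + z b) ⊗ (a + z̄ b)` with `z` a fourth root of unity. -/
theorem ketbra_add_mem_separableCone (hne : (pureProduct X X).Nonempty) (a b : X) :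
    ketbra (tmul a a + tmul b b) + ketbra (tmul a b) + ketbra (tmul b a) ∈ separableCone X X := by
  have h := fun z : ℂ => ketbra_tmul_mem_separableCone hne (a + z • b) (a + starRingEnd ℂ z • b)
  have hexp : ∀ z : ℂ, ‖z‖ = 1 → tmul (a + z • b) (a + starRingEnd ℂ z • b) =
      (tmul a a + tmul b b) + starRingEnd ℂ z • tmul a b + z • (tmul b a : HTensor X X) := by
    intro z hz
    have hz' : z * starRingEnd ℂ z = 1 := by rw [RCLike.mul_conj, hz]; simp
    rw [← tmulL_apply]
    simp only [map_add, map_smul, _root_.add_apply, _root_.smul_apply, smul_add, smul_smul, hz',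
      one_smul, tmulL_apply, mul_comm (starRingEnd ℂ z) z]
    abel
  have key := sum_ketbra_fourthRoots (tmul a a + tmul b b : HTensor X X) (tmul a b) (tmul b a)
  have hmem := add_mem_separableCone (add_mem_separableCone (add_mem_separableCone (h 1) (h (-1)))
    (h Complex.I)) (h (-Complex.I))
  rw [hexp 1 (by simp), hexp (-1) (by simp), hexp Complex.I (by simp),
    hexp (-Complex.I) (by simp)] at hmem
  simp only [map_one, map_neg, Complex.conj_I, neg_neg, one_smul, neg_smul, ← sub_eq_add_neg]
    at hmem
  rw [key] at hmem
  have := smul_mem_separableCone (a := 4⁻¹) (by norm_num) hmem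
  rw [smul_smul] at this
  norm_num at this
  exact this

variable {ι : Type*} [Fintype ι]

/-- With `Ω = ∑ i, b i ⊗ b i` and `d` the number of the `b i`, the operator
`d ∑ i, |ii⟩⟨ii| + ∑ i j, |ij⟩⟨ij| + |Ω⟩⟨Ω|` is separable up to normalization: twice this operator is
the sum over all `i` and `j` of the operators in `ketbra_add_mem_separableCone`. -/
theorem add_ketbra_sum_mem_separableCone (hne : (pureProduct X X).Nonempty) (b : ι → X) :
    (Fintype.card ι : ℂ) • ∑ i, ketbra (tmul (b i) (b i)) + ∑ i, ∑ j, ketbra (tmul (b i) (b j)) +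
      ketbra (∑ i, tmul (b i) (b i)) ∈ separableCone X X := by
  set Ω : HTensor X X := ∑ i, tmul (b i) (b i) with hΩ
  let k : ι → ι → HTensor X X →L[ℂ] HTensor X X := fun i j => ketbra (tmul (b i) (b j))
  have hsum := sum_mem_separableCone hne Finset.univ (P := fun i => ∑ j,
    (ketbra (tmul (b i) (b i) + tmul (b j) (b j)) + k i j + k j i)) fun i _ =>
    sum_mem_separableCone hne _ fun j _ => ketbra_add_mem_separableCone hne (b i) (b j)
  have hΩ3 : ∑ i, ∑ j, InnerProductSpace.rankOne ℂ (tmul (b j) (b j) : HTensor X X)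
      (tmul (b i) (b i) : HTensor X X) = ketbra Ω := by
    rw [ketbra, hΩ]
    simp only [map_sum, _root_.sum_apply]
  have hΩ2 : ∑ i, ∑ j, InnerProductSpace.rankOne ℂ (tmul (b i) (b i) : HTensor X X)
      (tmul (b j) (b j) : HTensor X X) = ketbra Ω := by
    rw [Finset.sum_comm, hΩ3]
  have hQ' : ∑ i, ∑ j, k j i = ∑ i, ∑ j, k i j := Finset.sum_comm
  have hD1 : ∑ i, ∑ _j : ι, k i i = (Fintype.card ι : ℂ) • ∑ i, k i i := by
    simp only [Finset.sum_const, Finset.card_univ, ← Finset.smul_sum]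
    rw [← Nat.cast_smul_eq_nsmul ℂ]
  have hD2 : ∑ _i : ι, ∑ j, k j j = (Fintype.card ι : ℂ) • ∑ i, k i i := by
    rw [Finset.sum_comm, hD1]
  have heq : ∑ i, ∑ j, (ketbra (tmul (b i) (b i) + tmul (b j) (b j)) + k i j + k j i) =
      (2 : ℂ) • ((Fintype.card ι : ℂ) • ∑ i, k i i + ∑ i, ∑ j, k i j + ketbra Ω) := by
    simp only [ketbra_add_eq, Finset.sum_add_distrib]
    rw [hΩ2, hΩ3, hQ']
    change ∑ i, ∑ _j : ι, k i i + ∑ _i : ι, ∑ j, k j j + _ + _ + _ + _ = _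
    rw [hD1, hD2]
    module
  rw [heq] at hsum
  have := smul_mem_separableCone (a := 2⁻¹) (by norm_num) hsum
  rw [smul_smul] at this
  norm_num at this
  exact this

theorem norm_sum_tmul_sq {b : ι → X} (hb : Orthonormal ℂ b) :
    ‖(∑ i, tmul (b i) (b i) : HTensor X X)‖ ^ 2 = Fintype.card ι := by
  have hon : Orthonormal ℂ fun i => (tmul (b i) (b i) : HTensor X X) :=
    (orthonormal_tmul hb hb).comp (fun i => (i, i)) fun i j h => (Prod.mk.inj h).1
  have := hon.inner_sum (fun _ => 1) (fun _ => 1) Finset.univ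
  simp only [one_smul, map_one, mul_one, Finset.sum_const, Finset.card_univ, nsmul_eq_mul,
    inner_self_eq_norm_sq_to_K] at this
  change ((‖(∑ i, tmul (b i) (b i) : HTensor X X)‖ : ℝ) : ℂ) ^ 2 = _ at this
  exact_mod_cast this

theorem norm_maximallyEntangled [Nonempty ι] {b : ι → X} (hb : Orthonormal ℂ b)
    {Φ : HTensor X X}
    (hΦ : Φ = ((√(Fintype.card ι : ℝ))⁻¹ : ℂ) • ∑ i, tmul (b i) (b i)) : ‖Φ‖ = 1 := by
  have h := norm_sum_tmul_sq hb
  have hd0 : (0 : ℝ) < Fintype.card ι := by exact_mod_cast Fintype.card_pos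
  rw [hΦ, norm_smul, norm_inv, Complex.norm_real, Real.norm_of_nonneg (Real.sqrt_nonneg _), ← h,
    Real.sqrt_sq (norm_nonneg _), inv_mul_cancel₀]
  intro h0
  rw [h0] at h
  norm_num at h
  exact hd0.ne' h.symm

/-- The points on the segment from `R / (2 d ^ 2)` to `(R + d P) / (2 d ^ 2 + d)` are the mixtures of
`P` and `R / (2 d ^ 2)` with a small weight of `P`. -/
theorem smul_add_smul_mem_of_segment {H : Type*} [NormedAddCommGroup H] [InnerProductSpace ℂ H]
    {S : Set (H →L[ℂ] H)} (hS : Convex ℝ S) {d : ℝ} (hd : 0 < d) {R P : H →L[ℂ] H}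
    (h₁ : (d * d + d * d)⁻¹ • R ∈ S) (h₂ : (d * d + d * d + d)⁻¹ • (R + (d : ℂ) • P) ∈ S)
    {p : ℝ} (hp : 0 ≤ p) (hp' : p ≤ d / (d * d + d * d + d)) :
    p • P + (1 - p) • (d * d + d * d)⁻¹ • R ∈ S := by
  have hW₂ : (0 : ℝ) < d * d + d * d + d := by positivity
  have h1 : d * d + d * d ≠ 0 := by positivity
  have hl : p * (d * d + d * d + d) / d ≤ 1 := by
    rw [div_le_one hd]
    rwa [le_div_iff₀ hW₂] at hp'
  have := hS h₂ h₁ (a := p * (d * d + d * d + d) / d)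
    (b := 1 - p * (d * d + d * d + d) / d) (by positivity) (by linarith) (by ring)
  convert! this using 1
  rw [← real_smul_eq]
  match_scalars
  · field_simp
  · field_simp
    ring

/-- Around some separable state, the maximally entangled state may be mixed in with a small weight
without leaving the convex hull of the product states. -/
theorem exists_mix_mem_convexHull [Nonempty ι] {b : ι → X} (hb : Orthonormal ℂ b)
    {Φ : HTensor X X}
    (hΦ : Φ = ((√(Fintype.card ι : ℝ))⁻¹ : ℂ) • ∑ i, tmul (b i) (b i)) :
    ∃ (p₀ : ℝ) (τ : HTensor X X →L[ℂ] HTensor X X), 0 < p₀ ∧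
      ∀ p : ℝ, 0 ≤ p → p ≤ p₀ →
        p • ketbra Φ + (1 - p) • τ ∈ convexHull ℝ (pureProduct X X) := by
  have hΦtr : trace (ketbra Φ) = 1 := by
    rw [trace_ketbra, norm_maximallyEntangled hb hΦ]; simp
  have hd0 : (0 : ℝ) < Fintype.card ι := by exact_mod_cast Fintype.card_pos
  have hΩΦ : ketbra (∑ i, tmul (b i) (b i) : HTensor X X) = (Fintype.card ι : ℂ) • ketbra Φ := by
    have h : ‖((√(Fintype.card ι : ℝ))⁻¹ : ℂ)‖ ^ 2 = (Fintype.card ι : ℝ)⁻¹ := by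
      rw [norm_inv, Complex.norm_real, Real.norm_of_nonneg (Real.sqrt_nonneg _), inv_pow,
        Real.sq_sqrt hd0.le]
    have hdC : (Fintype.card ι : ℂ) ≠ 0 := by exact_mod_cast hd0.ne'
    rw [hΦ, ketbra_smul, smul_smul, h, Complex.ofReal_inv, Complex.ofReal_natCast,
      mul_inv_cancel₀ hdC, one_smul]
  obtain ⟨i₀⟩ := ‹Nonempty ι›
  have hne : (pureProduct X X).Nonempty :=
    ⟨_, b i₀, b i₀, hb.norm_eq_one i₀, hb.norm_eq_one i₀, rfl⟩
  have hR₂ := add_ketbra_sum_mem_separableCone hne b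
  rw [hΩΦ] at hR₂
  have hk : ∀ i j, ketbra (tmul (b i) (b j)) ∈ separableCone X X :=
    fun i j => ketbra_tmul_mem_separableCone hne _ _
  have hktr : ∀ i j, trace (ketbra (tmul (b i) (b j) : HTensor X X)) = 1 := fun i j => by
    rw [trace_ketbra, norm_tmul, hb.norm_eq_one, hb.norm_eq_one]; simp
  have hktc : ∀ i j, IsTraceClass (ketbra (tmul (b i) (b j) : HTensor X X)) :=
    fun i j => isTraceClass_ketbra _
  have hDtc := isTraceClass_sum Finset.univ fun i _ => hktc i i
  have hQtc := isTraceClass_sum Finset.univ fun i _ => isTraceClass_sum Finset.univ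
    fun j _ => hktc i j
  have hR₁ := add_mem_separableCone (smul_mem_separableCone hd0.le
      (sum_mem_separableCone hne Finset.univ fun i _ => hk i i))
    (sum_mem_separableCone hne Finset.univ fun i _ =>
      sum_mem_separableCone hne Finset.univ fun j _ => hk i j)
  have hDtr : trace (∑ i, ketbra (tmul (b i) (b i) : HTensor X X)) = Fintype.card ι := by
    rw [trace_sum _ fun i _ => hktc i i]
    simp [hktr]
  have hQtr : trace (∑ i, ∑ j, ketbra (tmul (b i) (b j) : HTensor X X)) =
      (Fintype.card ι : ℂ) * Fintype.card ι := by
    rw [trace_sum _ fun i _ => isTraceClass_sum _ fun j _ => hktc i j,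
      Finset.sum_congr rfl fun i _ => trace_sum _ fun j _ => hktc i j]
    simp [hktr]
  rw [Complex.ofReal_natCast] at hR₁
  have htr₁ : trace ((Fintype.card ι : ℂ) • ∑ i, ketbra (tmul (b i) (b i) : HTensor X X) +
      ∑ i, ∑ j, ketbra (tmul (b i) (b j))) =
      ((Fintype.card ι * Fintype.card ι + Fintype.card ι * Fintype.card ι : ℝ) : ℂ) := by
    rw [(hDtc.smul _).trace_add hQtc, trace_smul, hDtr, hQtr]
    push_cast; ring
  have htr₂ : trace ((Fintype.card ι : ℂ) • ∑ i, ketbra (tmul (b i) (b i) : HTensor X X) +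
      ∑ i, ∑ j, ketbra (tmul (b i) (b j)) + (Fintype.card ι : ℂ) • ketbra Φ) =
      ((Fintype.card ι * Fintype.card ι + Fintype.card ι * Fintype.card ι + Fintype.card ι : ℝ) :
        ℂ) := by
    rw [((hDtc.smul _).add hQtc).trace_add ((isTraceClass_ketbra Φ).smul _), htr₁, trace_smul,
      hΦtr]
    push_cast; ring
  generalize hR : (Fintype.card ι : ℂ) • ∑ i, ketbra (tmul (b i) (b i) : HTensor X X) +
      ∑ i, ∑ j, ketbra (tmul (b i) (b j)) = R at hR₁ hR₂ htr₁ htr₂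
  rw [← Complex.ofReal_natCast] at hR₂ htr₂
  generalize (Fintype.card ι : ℝ) = d at *
  have hW₁ : (0 : ℝ) < d * d + d * d := by positivity
  have hW₂ : (0 : ℝ) < d * d + d * d + d := by positivity
  have h₁ := mem_convexHull_of_mem_separableCone hR₁ hW₁ htr₁
  have h₂ := mem_convexHull_of_mem_separableCone hR₂ hW₂ htr₂
  refine ⟨d / (d * d + d * d + d), (d * d + d * d)⁻¹ • R, by positivity, fun p hp hp' => ?_⟩
  exact smul_add_smul_mem_of_segment (convex_convexHull ℝ _) hd0 h₁ h₂ hp hp'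

end Isotropic

/-! ### Measure-and-prepare channels and fidelity with a pure state -/

section Channel

variable {H : Type*} [NormedAddCommGroup H] [InnerProductSpace ℂ H]

theorem blockPos_add {k : ℕ} {X Y : Fin k → Fin k → (H →L[ℂ] H)} (hX : BlockPos X)
    (hY : BlockPos Y) : BlockPos fun i j => X i j + Y i j := fun v => by
  simp only [_root_.add_apply, inner_add_right, Finset.sum_add_distrib]
  exact add_nonneg (hX v) (hY v)

variable [CompleteSpace H]
variable {K : Type*} [NormedAddCommGroup K] [InnerProductSpace ℂ K] [CompleteSpace K]

/-- Complete positivity of the map `X ↦ tr (N X) P` for positive `N` and `P`. -/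
theorem blockPos_trace_smul {N : H →L[ℂ] H} {P : K →L[ℂ] K} (hN : 0 ≤ N) (hP : 0 ≤ P) {k : ℕ}
    {X : Fin k → Fin k → (H →L[ℂ] H)} (htc : ∀ i j, IsTraceClass (X i j)) (hX : BlockPos X) :
    BlockPos fun i j => trace (N * X i j) • P := by
  intro v
  let c : BasisIndex K → Fin k → ℂ := fun a j => ⟪onb K a, CFC.sqrt P (v j)⟫_ℂ
  have h1 : ∀ i j, HasSum (fun a => trace (N * X i j) * (starRingEnd ℂ (c a i) * c a j))
      ⟪v i, (trace (N * X i j) • P) (v j)⟫_ℂ := by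
    intro i j
    rw [_root_.smul_apply, inner_smul_right]
    refine HasSum.mul_left _ ?_
    have := (onb K).hasSum_inner_mul_inner (CFC.sqrt P (v i)) (CFC.sqrt P (v j))
    rw [← ContinuousLinearMap.adjoint_inner_right, ← ContinuousLinearMap.star_eq_adjoint,
      ← mul_apply_eq_comp, star_sqrt_mul_sqrt hP] at this
    simpa only [c, inner_conj_symm] using this
  have h2 := hasSum_sum (s := Finset.univ) fun i _ => hasSum_sum (s := Finset.univ)
    fun j _ => h1 i j
  refine h2.nonneg fun a => ?_
  have hY : IsTraceClass (∑ i, ∑ j, (starRingEnd ℂ (c a i) * c a j) • X i j) :=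
    isTraceClass_sum _ fun i _ => isTraceClass_sum _ fun j _ => (htc i j).smul _
  have hY0 : 0 ≤ ∑ i, ∑ j, (starRingEnd ℂ (c a i) * c a j) • X i j := by
    rw [nonneg_iff_inner_nonneg]
    intro x
    have := hX fun i => c a i • x
    convert! this using 1
    simp only [_root_.sum_apply, inner_sum, _root_.smul_apply, map_smul, inner_smul_left,
      inner_smul_right]
    exact Finset.sum_congr rfl fun i _ => Finset.sum_congr rfl fun j _ => by ring
  have h3 := trace_mul_nonneg hN hY0 hY
  rw [Finset.mul_sum, trace_sum _ fun i _ => (isTraceClass_sum _ fun j _ =>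
    (htc i j).smul _).mul_left N] at h3
  convert! h3 using 1
  refine Finset.sum_congr rfl fun i _ => ?_
  rw [Finset.mul_sum, trace_sum _ fun j _ => ((htc i j).smul _).mul_left N]
  refine Finset.sum_congr rfl fun j _ => ?_
  rw [mul_smul_comm, trace_smul, mul_comm]

/-- The measure-and-prepare channel: perform the test `M` and prepare `ω` if the complementary
outcome occurs, and `τ` otherwise. -/
def measurePrepare (M : H →L[ℂ] H) (ω τ : K →L[ℂ] K) (X : H →L[ℂ] H) : K →L[ℂ] K :=
  trace ((1 - M) * X) • ω + trace (M * X) • τ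

theorem enorm_trace_mul_le {X : H →L[ℂ] H} (hX : IsTraceClass X) (M : H →L[ℂ] H) :
    ‖trace (M * X)‖ₑ ≤ ‖M‖ₑ * traceNorm X := by
  have := ENNReal.ofReal_le_ofReal (hX.norm_trace_mul_left_le M)
  rwa [ENNReal.ofReal_mul (norm_nonneg _), ofReal_norm, ofReal_norm,
    ENNReal.ofReal_toReal hX.ne] at this

theorem isChannel_measurePrepare {M : H →L[ℂ] H} (h0 : 0 ≤ M) (h1 : M ≤ 1) {ω τ : K →L[ℂ] K}
    (hω : IsState ω) (hτ : IsState τ) : IsChannel (measurePrepare M ω τ) where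
  traceClass X _ := (hω.2.1.smul _).add (hτ.2.1.smul _)
  map_add X Y hX hY := by
    simp only [measurePrepare, mul_add, (hX.mul_left _).trace_add (hY.mul_left _), add_smul]
    abel
  map_smul c X _ := by
    simp only [measurePrepare, mul_smul_comm, trace_smul, smul_add, mul_smul]
  bounded := by
    refine ⟨(‖1 - M‖ₑ * traceNorm ω + ‖M‖ₑ * traceNorm τ).toNNReal, fun X hX => ?_⟩
    have hωt : traceNorm ω ≠ ⊤ := hω.2.1.ne
    have hτt : traceNorm τ ≠ ⊤ := hτ.2.1.ne
    rw [ENNReal.coe_toNNReal (by finiteness), add_mul]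
    refine (traceNorm_add_le _ _).trans (add_le_add ?_ ?_) <;>
    · refine (traceNorm_smul_le _ _).trans ((mul_le_mul_left (enorm_trace_mul_le hX _) _).trans_eq ?_)
      ring
  completely_pos k X hX hpos :=
    blockPos_add (blockPos_trace_smul (sub_nonneg.2 h1) hω.1 hX hpos)
      (blockPos_trace_smul h0 hτ.1 hX hpos)
  trace_preserving X hX := by
    rw [measurePrepare, (hω.2.1.smul _).trace_add (hτ.2.1.smul _), trace_smul, trace_smul, hω.2.2,
      hτ.2.2, mul_one, mul_one, ← (hX.mul_left _).trace_add (hX.mul_left _), ← add_mul,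
      sub_add_cancel, one_mul]

theorem traceNorm_rankOne (x y : H) :
    (traceNorm (InnerProductSpace.rankOne ℂ x y)).toReal = ‖x‖ * ‖y‖ :=
  (traceNorm_rankOne_le x y).antisymm
    ((InnerProductSpace.norm_rankOne x y).ge.trans (isTraceClass_rankOne x y).norm_le)

/-- The fidelity with a pure state is the overlap `⟨x, ω x⟩`: the operator `√ω |x⟩⟨x|` has rank one, so
that its trace norm is `‖√ω x‖`. -/
theorem fidelity_ketbra {ω : H →L[ℂ] H} (hω : 0 ≤ ω) {x : H} (hx : ‖x‖ = 1) :
    fidelity ω (ketbra x) = (⟪x, ω x⟫_ℂ).re := by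
  have hs : CFC.sqrt (ketbra x) = ketbra x :=
    CFC.sqrt_unique (InnerProductSpace.isIdempotentElem_rankOne_self hx) (ketbra_nonneg x)
  have hmul : CFC.sqrt ω * ketbra x = InnerProductSpace.rankOne ℂ (CFC.sqrt ω x) x := by
    ext v
    simp [ketbra]
  rw [fidelity, hs, hmul, traceNorm_rankOne, hx, mul_one, ← star_sqrt_mul_sqrt hω,
    inner_star_mul_self, star_sqrt_mul_sqrt hω, Complex.ofReal_re]

end Channel

/-! ### The binary logarithm -/

section Log

theorem log2_strictMono : StrictMono log2 := fun x y h => by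
  have h2 : (0 : EReal) < (Real.log 2 : EReal) := by
    exact_mod_cast Real.log_pos one_lt_two
  exact EReal.strictMono_div_right_of_pos h2 (EReal.coe_ne_top _) (ENNReal.log_strictMono h)

theorem exists_log2_eq (y : EReal) : ∃ x, log2 x = y := by
  have h2 : (0 : EReal) < (Real.log 2 : EReal) := by
    exact_mod_cast Real.log_pos one_lt_two
  obtain ⟨x, hx⟩ := ENNReal.logOrderIso.surjective (y * (Real.log 2 : EReal))
  refine ⟨x, ?_⟩
  have hx' : ENNReal.log x = y * (Real.log 2 : EReal) := hx
  rw [log2, hx', ← EReal.mul_div, EReal.div_self (EReal.coe_ne_bot _) (EReal.coe_ne_top _) h2.ne',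
    mul_one]

end Log

/-! ### Channels in the Heisenberg picture -/

section Converse

variable {H K : Type*} [NormedAddCommGroup H] [InnerProductSpace ℂ H] [CompleteSpace H]
  [NormedAddCommGroup K] [InnerProductSpace ℂ K] [CompleteSpace K]

theorem IsChannel.map_nonneg {Λ : (H →L[ℂ] H) → (K →L[ℂ] K)} (hΛ : IsChannel Λ) {X : H →L[ℂ] H}
    (hX : IsTraceClass X) (h0 : 0 ≤ X) : 0 ≤ Λ X := by
  rw [nonneg_iff_inner_nonneg] at h0 ⊢
  intro x
  have := hΛ.completely_pos 1 (fun _ _ => X) (fun _ _ => hX) (fun v => by simpa using h0 (v 0))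
    fun _ => x
  simpa using this

theorem IsChannel.isState {Λ : (H →L[ℂ] H) → (K →L[ℂ] K)} (hΛ : IsChannel Λ) {X : H →L[ℂ] H}
    (hX : IsState X) : IsState (Λ X) :=
  ⟨hΛ.map_nonneg hX.2.1 hX.1, hΛ.traceClass X hX.2.1, by
    rw [hΛ.trace_preserving X hX.2.1, hX.2.2]⟩

/-- The Heisenberg picture of a channel, for the test `|Φ⟩⟨Φ|` on the output. Positivity of the
channel gives `0 ≤ N`, and preservation of the trace gives `N ≤ 1`. -/
theorem IsChannel.exists_test {Λ : (H →L[ℂ] H) → (K →L[ℂ] K)} (hΛ : IsChannel Λ) {Φ : K}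
    (hΦ : ‖Φ‖ = 1) : ∃ N : H →L[ℂ] H, 0 ≤ N ∧ N ≤ 1 ∧
      ∀ X, IsTraceClass X → ⟪Φ, Λ X Φ⟫_ℂ = trace (N * X) := by
  obtain ⟨C, hC⟩ := hΛ.bounded
  obtain ⟨N, hN⟩ := exists_eq_trace_mul (fun X => ⟪Φ, Λ X Φ⟫_ℂ) C C.2
    (fun X Y hX hY => by
      rw [hΛ.map_add X Y hX hY, _root_.add_apply, inner_add_right])
    (fun c X hX => by rw [hΛ.map_smul c X hX, _root_.smul_apply, inner_smul_right])
    (fun X hX => by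
      have h1 : ‖⟪Φ, Λ X Φ⟫_ℂ‖ ≤ ‖Λ X‖ := by
        refine (norm_inner_le_norm _ _).trans ?_
        simpa [hΦ] using (Λ X).le_opNorm Φ
      refine h1.trans ((hΛ.traceClass X hX).norm_le.trans ?_)
      have hXt : traceNorm X ≠ ⊤ := hX.ne
      simpa using ENNReal.toReal_mono (by finiteness) (hC X hX))
  refine ⟨N, ?_, ?_, hN⟩
  · rw [nonneg_iff_inner_nonneg]
    intro x
    rw [← trace_mul_ketbra, ← hN _ (isTraceClass_ketbra x)]
    exact nonneg_iff_inner_nonneg.1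
      (hΛ.map_nonneg (isTraceClass_ketbra x) (ketbra_nonneg x)) Φ
  · rw [← sub_nonneg, nonneg_iff_inner_nonneg]
    intro x
    have htc := isTraceClass_ketbra x
    have htc' := hΛ.traceClass _ htc
    have h1 := trace_mul_nonneg (sub_nonneg.2 (ketbra_le_one hΦ))
      (hΛ.map_nonneg htc (ketbra_nonneg x)) htc'
    rw [htc'.trace_mul_comm, mul_sub, mul_one, htc'.trace_sub (htc'.mul_right _),
      trace_mul_ketbra, hΛ.trace_preserving _ htc, hN _ htc] at h1
    rwa [← trace_mul_ketbra, sub_mul, one_mul, htc.trace_sub (htc.mul_left N)]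

end Converse

/-! ### Overlap with the maximally entangled state -/

section Overlap

variable {X : Type u} [NormedAddCommGroup X] [InnerProductSpace ℂ X]

/-- The overlap of a separable state with the maximally entangled state of rank `d` is at most
`1 / d`. -/
theorem overlap_le_of_mem_separable {ι : Type*} [Fintype ι] {b : ι → X} (hb : Orthonormal ℂ b)
    {Φ : HTensor X X}
    (hΦ : Φ = ((√(Fintype.card ι : ℝ))⁻¹ : ℂ) • ∑ i, tmul (b i) (b i))
    {σ : HTensor X X →L[ℂ] HTensor X X} (hσ : σ ∈ separable X X) :
    (⟪Φ, σ Φ⟫_ℂ).re ≤ (Fintype.card ι : ℝ)⁻¹ := by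
  have hst := isState_of_mem_separable hσ
  have hcs : ∀ ψ φ : X, ‖ψ‖ = 1 → ‖φ‖ = 1 →
      ‖⟪tmul ψ φ, Φ⟫_ℂ‖ ^ 2 ≤ (Fintype.card ι : ℝ)⁻¹ := by
    intro ψ φ hψ hφ
    -- the inequalities of Cauchy–Schwarz and Bessel
    have h1 : ‖∑ i, ⟪ψ, b i⟫_ℂ * ⟪φ, b i⟫_ℂ‖ ≤ 1 := by
      calc ‖∑ i, ⟪ψ, b i⟫_ℂ * ⟪φ, b i⟫_ℂ‖ ≤ ∑ i, ‖⟪b i, ψ⟫_ℂ‖ * ‖⟪b i, φ⟫_ℂ‖ := by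
            refine norm_sum_le_of_le _ fun i _ => ?_
            rw [norm_mul, norm_inner_symm, norm_inner_symm φ]
        _ ≤ √(∑ i, ‖⟪b i, ψ⟫_ℂ‖ ^ 2) * √(∑ i, ‖⟪b i, φ⟫_ℂ‖ ^ 2) :=
            Real.sum_mul_le_sqrt_mul_sqrt _ _ _
        _ ≤ √(‖ψ‖ ^ 2) * √(‖φ‖ ^ 2) := by
            gcongr <;> exact hb.sum_inner_products_le _
        _ = 1 := by simp [hψ, hφ]
    rw [hΦ, inner_smul_right, inner_sum]
    simp only [inner_tmul]
    rw [norm_mul, mul_pow, norm_inv, Complex.norm_real, Real.norm_of_nonneg (Real.sqrt_nonneg _),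
      inv_pow, Real.sq_sqrt (by positivity)]
    exact mul_le_of_le_one_right (by positivity) (pow_le_one₀ (norm_nonneg _) h1)
  have h := le_re_trace_mul_of_mem_separable (N := -ketbra Φ) (c := -(Fintype.card ι : ℝ)⁻¹)
    (fun ψ φ hψ hφ => by
      have := hcs ψ φ hψ hφ
      rw [_root_.neg_apply, ketbra_apply, inner_neg_right, inner_smul_right, ← inner_conj_symm,
        RCLike.conj_mul, Complex.neg_re]
      refine neg_le_neg ((Complex.re_le_norm _).trans ?_)
      simpa using this) hσ
  have h2 : trace (-ketbra Φ * σ) = -⟪Φ, σ Φ⟫_ℂ := by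
    have h3 : -ketbra Φ * σ = (-1 : ℂ) • (ketbra Φ * σ) := by rw [neg_one_smul, neg_mul]
    rw [h3, trace_smul, hst.2.1.trace_mul_comm, trace_mul_ketbra, neg_one_mul]
  rw [h2, Complex.neg_re] at h
  linarith

end Overlap

/-! ### Distillation protocols and entanglement tests -/

section Bounds

variable {A : Type u} [NormedAddCommGroup A] [InnerProductSpace ℂ A]
variable {B : Type v} [NormedAddCommGroup B] [InnerProductSpace ℂ B]

/-- A distillation protocol yields a test of entanglement against all separable states, namely
`1 - N` with `N` the test `|Φ⟩⟨Φ|` in the Heisenberg picture. -/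
theorem neg_log2_le_hypoTestSep {X : Type*} [NormedAddCommGroup X] [InnerProductSpace ℂ X]
    {ι : Type*} [Fintype ι] [Nonempty ι] {b : ι → X} (hb : Orthonormal ℂ b) {Φ : HTensor X X}
    (hΦ : Φ = ((√(Fintype.card ι : ℝ))⁻¹ : ℂ) • ∑ i, tmul (b i) (b i))
    {ρ : HTensor A B →L[ℂ] HTensor A B} (hρ : IsState ρ)
    {Λ : (HTensor A B →L[ℂ] HTensor A B) → (HTensor X X →L[ℂ] HTensor X X)} (hΛ : IsChannel Λ)
    (hsep : ∀ σ ∈ separable A B, Λ σ ∈ separable X X) {ε : ℝ≥0}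
    (hF : fidelity (Λ ρ) (ketbra Φ) ≥ 1 - (ε : ℝ)) :
    -log2 ε ≤ hypoTestSep (Fintype.card ι : ℝ)⁻¹ ρ := by
  have hΦ1 := norm_maximallyEntangled hb hΦ
  obtain ⟨N, hN0, hN1, hN⟩ := hΛ.exists_test hΦ1
  refine le_iInf₂ fun σ hσ => EReal.neg_le_neg_iff.2 (log2_strictMono.monotone (sInf_le_of_le
    ⟨1 - N, sub_nonneg.2 hN1, sub_le_self _ hN0, ?_, rfl⟩ ?_))
  · rw [sub_sub_cancel, ← hN σ (isState_of_mem_separable hσ).2.1]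
    exact overlap_le_of_mem_separable hb hΦ (hsep σ hσ)
  · rw [fidelity_ketbra (hΛ.isState hρ).1 hΦ1, hN ρ hρ.2.1] at hF
    rw [sub_mul, one_mul, hρ.2.1.trace_sub (hρ.2.1.mul_left N), hρ.2.2, Complex.sub_re,
      Complex.one_re]
    refine (ENNReal.ofReal_le_ofReal (q := (ε : ℝ)) (by linarith)).trans_eq ?_
    simp

/-- Tests against the individual separable states combine, by the minimax principle, into a single
test that is good for all of them. -/
theorem exists_test_of_hypoTestSep {ρ : HTensor A B →L[ℂ] HTensor A B} (hρ : IsState ρ) {δ : ℝ}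
    (hδ : 0 ≤ δ) : ∃ (ε : ℝ≥0) (M : HTensor A B →L[ℂ] HTensor A B), 0 ≤ M ∧ M ≤ 1 ∧
      (trace (M * ρ)).re ≤ ε ∧ (∀ σ ∈ separable A B, 1 - δ ≤ (trace (M * σ)).re) ∧
      hypoTestSep δ ρ ≤ -log2 ε := by
  obtain ⟨y, hy⟩ := exists_log2_eq (-hypoTestSep δ ρ)
  -- the optimal error is at most `1`, by the trivial test `M = 1`, so that it is finite
  have hlt : min y 1 ≠ ⊤ := ((min_le_right y 1).trans_lt ENNReal.one_lt_top).ne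
  have hle : ∀ σ ∈ separable A B, sInf {t | ∃ M : HTensor A B →L[ℂ] HTensor A B, 0 ≤ M ∧ M ≤ 1 ∧
      (trace ((1 - M) * σ)).re ≤ δ ∧ t = ENNReal.ofReal (trace (M * ρ)).re} ≤ min y 1 := by
    intro σ hσ
    refine le_min ?_ (sInf_le ⟨1, zero_le_one, le_rfl, ?_, ?_⟩)
    · rw [← log2_strictMono.le_iff_le, hy]
      have : hypoTestSep δ ρ ≤ hypoTest δ σ ρ := iInf₂_le σ hσ
      rw [EReal.le_neg]
      exact this
    · simpa [trace] using hδ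
    · rw [one_mul, hρ.2.2]
      simp
  let V : Set (HTensor A B) := {v | ∃ (ψ : A) (φ : B), ‖ψ‖ = 1 ∧ ‖φ‖ = 1 ∧ v = tmul ψ φ}
  obtain ⟨M, hM0, hM1, hMρ, hMV⟩ := exists_universal_test hρ.1 hρ.2.1 V (min y 1).toReal (1 - δ)
    ENNReal.toReal_nonneg fun F w hw η hη => by
      have hmem : ∑ v : F, w v • ketbra (v : HTensor A B) ∈ convexHull ℝ (pureProduct A B) := by
        refine (convex_convexHull ℝ _).sum_mem (fun v _ => hw.1 v) hw.2 fun v _ =>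
          subset_convexHull ℝ _ ?_
        obtain ⟨ψ, φ, hψ, hφ, h⟩ := v.1.2
        exact ⟨ψ, φ, hψ, hφ, by rw [h, opTensor_ketbra]⟩
      have h1 : min y 1 < ENNReal.ofReal ((min y 1).toReal + η) := by
        rw [ENNReal.ofReal_add ENNReal.toReal_nonneg hη.le, ENNReal.ofReal_toReal hlt]
        exact ENNReal.lt_add_right hlt (by simpa using hη)
      obtain ⟨_, ⟨M, hM0, hM1, hMσ, rfl⟩, hMt⟩ :=
        sInf_lt_iff.1 ((hle _ (convexHull_subset_separable hmem)).trans_lt h1)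
      refine ⟨M, hM0, hM1, ?_, ?_⟩
      · exact ((ENNReal.ofReal_lt_ofReal_iff_of_nonneg
          (re_trace_mul_nonneg hM0 hρ.1 hρ.2.1)).1 hMt).le
      · have hst := isState_of_mem_convexHull hmem
        rw [sub_mul, one_mul, hst.2.1.trace_sub (hst.2.1.mul_left M), hst.2.2, Complex.sub_re,
          Complex.one_re] at hMσ
        have h2 : (trace (M * ∑ v : F, w v • ketbra (v : HTensor A B))).re =
            ∑ v : F, w v * (⟪(v : HTensor A B), M v⟫_ℂ).re := by
          simp only [real_smul_eq, Finset.mul_sum, mul_smul_comm]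
          rw [trace_sum _ fun v _ => ((isTraceClass_ketbra _).mul_left M).smul _, Complex.re_sum]
          refine Finset.sum_congr rfl fun v _ => ?_
          rw [trace_smul, Complex.re_ofReal_mul, trace_mul_ketbra]
        linarith
  refine ⟨(min y 1).toNNReal, M, hM0, hM1, hMρ, fun σ hσ => ?_, ?_⟩
  · exact le_re_trace_mul_of_mem_separable (fun ψ φ hψ hφ => hMV _ ⟨ψ, φ, hψ, hφ, rfl⟩) hσ
  · rw [ENNReal.coe_toNNReal hlt, EReal.le_neg, ← hy]
    exact log2_strictMono.monotone (min_le_left _ _)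

/-- A test against all separable states with threshold `p₀` yields a distillation protocol: perform
the test and prepare `Φ` or `τ` according to the outcome. -/
theorem exists_distillation {X : Type*} [NormedAddCommGroup X] [InnerProductSpace ℂ X]
    {Φ : HTensor X X} (hΦ : ‖Φ‖ = 1) {τ : HTensor X X →L[ℂ] HTensor X X} {p₀ : ℝ} (hp₀ : 0 ≤ p₀)
    (hτ : ∀ p : ℝ, 0 ≤ p → p ≤ p₀ →
      p • ketbra Φ + (1 - p) • τ ∈ convexHull ℝ (pureProduct X X))
    {ρ : HTensor A B →L[ℂ] HTensor A B} (hρ : IsState ρ) :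
    ∃ (ε : ℝ≥0) (Λ : (HTensor A B →L[ℂ] HTensor A B) → (HTensor X X →L[ℂ] HTensor X X)),
      IsChannel Λ ∧ (∀ σ ∈ separable A B, Λ σ ∈ separable X X) ∧
      fidelity (Λ ρ) (ketbra Φ) ≥ 1 - (ε : ℝ) ∧ hypoTestSep p₀ ρ ≤ -log2 ε := by
  have hτ0 : IsState τ := isState_of_mem_convexHull (by simpa using hτ 0 le_rfl hp₀)
  obtain ⟨ε, M, hM0, hM1, hMρ, hMσ, hε⟩ := exists_test_of_hypoTestSep hρ hp₀
  have hch := isChannel_measurePrepare hM0 hM1 (isState_ketbra hΦ) hτ0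
  have hreal : ∀ σ : HTensor A B →L[ℂ] HTensor A B, IsState σ →
      trace (M * σ) = ((trace (M * σ)).re : ℂ) ∧
      trace ((1 - M) * σ) = ((1 - (trace (M * σ)).re : ℝ) : ℂ) := by
    intro σ hσ
    have h1 : trace (M * σ) = ((trace (M * σ)).re : ℂ) :=
      Complex.eq_re_of_ofReal_le (r := 0) (by simpa using trace_mul_nonneg hM0 hσ.1 hσ.2.1)
    refine ⟨h1, ?_⟩
    rw [sub_mul, one_mul, hσ.2.1.trace_sub (hσ.2.1.mul_left M), hσ.2.2]
    conv_lhs => rw [h1]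
    simp
  refine ⟨ε, measurePrepare M (ketbra Φ) τ, hch, fun σ hσ => ?_, ?_, hε⟩
  · have hst := isState_of_mem_separable hσ
    obtain ⟨h1, h2⟩ := hreal σ hst
    have h3 := re_trace_mul_nonneg (sub_nonneg.2 hM1) hst.1 hst.2.1
    rw [h2, Complex.ofReal_re] at h3
    have h4 := hτ (1 - (trace (M * σ)).re) h3 (by linarith [hMσ σ hσ])
    rw [measurePrepare, h2, h1, ← real_smul_eq, ← real_smul_eq, Complex.ofReal_re]
    rw [sub_sub_cancel] at h4
    exact convexHull_subset_separable h4
  · obtain ⟨h1, h2⟩ := hreal ρ hρ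
    have h3 := re_inner_nonneg hτ0.1 Φ
    have h4 := re_trace_mul_nonneg hM0 hρ.1 hρ.2.1
    rw [fidelity_ketbra (hch.isState hρ).1 hΦ, measurePrepare, h2, h1, _root_.add_apply,
      _root_.smul_apply, _root_.smul_apply, inner_add_right, inner_smul_right, inner_smul_right,
      ← trace_mul_ketbra, Complex.add_re, Complex.re_ofReal_mul, Complex.re_ofReal_mul]
    rw [trace_mul_ketbra, ketbra_apply, inner_smul_right, inner_self_eq_norm_sq_to_K, hΦ]
    simp only [Complex.ofReal_re]
    norm_num
    nlinarith [mul_nonneg h4 h3]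

theorem hypoTestSep_mono (ρ : HTensor A B →L[ℂ] HTensor A B) :
    Monotone fun ε => hypoTestSep ε ρ := fun _ _ h =>
  iInf₂_mono fun _ _ => EReal.neg_le_neg_iff.2 (log2_strictMono.monotone
    (sInf_le_sInf fun _ ⟨M, h0, h1, h2, ht⟩ => ⟨M, h0, h1, h2.trans h, ht⟩))

end Bounds

/-! ### Comparison of the exponents -/

section Exponents

variable {A : Type u} [NormedAddCommGroup A] [InnerProductSpace ℂ A] [CompleteSpace A]
variable {B : Type v} [NormedAddCommGroup B] [InnerProductSpace ℂ B] [CompleteSpace B]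

theorem liminf_div_mono {f g : ℕ → EReal} (h : ∀ n, f n ≤ g n) :
    liminf (fun n : ℕ => ((1 / n : ℝ) : EReal) * f n) atTop ≤
      liminf (fun n : ℕ => ((1 / n : ℝ) : EReal) * g n) atTop :=
  liminf_le_liminf (.of_forall fun n => mul_le_mul_of_nonneg_left (h n)
    (by exact_mod_cast (by positivity : (0 : ℝ) ≤ 1 / n)))

theorem sanovExponentAt_mono (ρ : HTensor A B →L[ℂ] HTensor A B) :
    Monotone (sanovExponentAt ρ) := fun _ _ h =>
  liminf_div_mono fun n => hypoTestSep_mono (opPow ρ n) h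

/-- The converse bound `E^(m) ≤ S(2 ^ (-m))`. -/
theorem distillExponentCopies_le {ρ : HTensor A B →L[ℂ] HTensor A B} (hρ : IsState ρ) (m : ℕ) :
    distillExponentCopies ρ m ≤ sanovExponentAt ρ ((1 / 2) ^ m) := by
  obtain ⟨ι, _, b, hcard, hb⟩ := exists_bellPow_eq m
  have : Nonempty ι := Fintype.card_pos_iff.1 (by rw [hcard]; positivity)
  have hcard' : (Fintype.card ι : ℝ) = 2 ^ m := by rw [hcard]; simp
  rw [← hcard'] at hb
  refine sSup_le ?_
  rintro x ⟨ε, Λ, hΛ, hF, rfl⟩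
  refine liminf_div_mono fun n => ?_
  have := neg_log2_le_hypoTestSep b.orthonormal hb (isState_opPow hρ n) (hΛ n).1 (hΛ n).2
    (ε := ε n) (by rw [← opPow_bell]; exact hF n)
  rwa [hcard', ← inv_pow, ← one_div] at this

/-- The achievability bound `S(p₀) ≤ E^(m)`, for a threshold depending on `m`. -/
theorem exists_le_distillExponentCopies {ρ : HTensor A B →L[ℂ] HTensor A B} (hρ : IsState ρ)
    (m : ℕ) : ∃ δ > 0, sanovExponentAt ρ δ ≤ distillExponentCopies ρ m := by
  obtain ⟨ι, _, b, hcard, hb⟩ := exists_bellPow_eq m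
  have : Nonempty ι := Fintype.card_pos_iff.1 (by rw [hcard]; positivity)
  have hcard' : (Fintype.card ι : ℝ) = 2 ^ m := by rw [hcard]; simp
  rw [← hcard'] at hb
  obtain ⟨p₀, τ, hp₀, hτ⟩ := exists_mix_mem_convexHull b.orthonormal hb
  refine ⟨p₀, hp₀, ?_⟩
  choose ε Λ hch hsep hF hε using fun n => exists_distillation
    (norm_maximallyEntangled b.orthonormal hb) hp₀.le hτ (isState_opPow hρ n)
  refine (liminf_div_mono hε).trans (le_sSup ⟨ε, Λ, fun n => ⟨hch n, hsep n⟩, fun n => ?_, rfl⟩)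
  rw [opPow_bell]
  exact hF n

end Exponents

end EntTest

end

theorem mainTheorem5
    {A : Type*} [NormedAddCommGroup A] [InnerProductSpace ℂ A] [CompleteSpace A]
    [TopologicalSpace.SeparableSpace A]
    {B : Type*} [NormedAddCommGroup B] [InnerProductSpace ℂ B] [CompleteSpace B]
    [TopologicalSpace.SeparableSpace B]
    (ρ : HTensor A B →L[ℂ] HTensor A B) (hρ : IsState ρ) :
    Tendsto (distillExponentCopies ρ) atTop (𝓝 (distillExponent ρ)) ∧
    Tendsto (sanovExponentAt ρ) (𝓝[>] 0) (𝓝 (sanovExponent ρ)) ∧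
    distillExponent ρ = sanovExponent ρ := by
  have hsanov := (sanovExponentAt_mono ρ).tendsto_nhdsGT 0
  set L := sInf (sanovExponentAt ρ '' Set.Ioi 0)
  have hup : Tendsto (fun m : ℕ => sanovExponentAt ρ ((1 / 2) ^ m)) atTop (𝓝 L) :=
    hsanov.comp (tendsto_pow_atTop_nhdsWithin_zero_of_lt_one (by norm_num) (by norm_num))
  have hdist : Tendsto (distillExponentCopies ρ) atTop (𝓝 L) := by
    refine tendsto_of_tendsto_of_tendsto_of_le_of_le tendsto_const_nhds hup (fun m => ?_)
      fun m => distillExponentCopies_le hρ m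
    obtain ⟨δ, hδ, hle⟩ := exists_le_distillExponentCopies hρ m
    exact (sInf_le (Set.mem_image_of_mem _ hδ)).trans hle
  have h1 : sanovExponent ρ = L := hsanov.limUnder_eq
  have h2 : distillExponent ρ = L := hdist.limUnder_eq
  exact ⟨h2 ▸ hdist, h1 ▸ hsanov, h2.trans h1.symm⟩
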